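/- Consider the following game. A speaker is a quack with probability $q\in(0,1)$ and an expert with probability $1-q$. The state $\omega$ is uniform on $[-1,1]$. The expert observes $\omega$ and sends a message according to a Markov kernel $F_E(\cdot\mid\omega)$ from $[-1,1]$ to $[-1,1]$; the quack knows nothing about $\omega$ and draws his message from a distribution $F_Q$ on $[-1,1]$. A judge observes the message $m$ and a signal $s=\omega+\epsilon$, where $\epsilon$ is independent and uniform on $[-\bar\epsilon,\bar\epsilon]$, $0<\bar\epsilon\le 1/2$. She selects the speaker (with a probability $\phi(m,s)\in[0,1]$, measurable in $(m,s)$), which pays her $1$ if he is an expert and $0$ if he is a quack, or takes an outside option worth $\mathcal U\in(0,1)$. The speaker wants to be selected. In a perfect Bayesian equilibrium, $F_E(\cdot\mid\omega)$ maximizes the expert's probability of being selected in every state $\omega$, $F_Q$ maximizes the quack's probability of being selected, the judge's belief is a version of the conditional probability, given $(m,s)$, that the speaker is an expert, and for all $(m,s)$ she selects the speaker if this belief exceeds $\mathcal U$ and takes the outside option if it is below $\mathcal U$. An equilibrium is best for the judge if no other equilibrium gives her a higher ex ante expected payoff. The expert is truthful if $F_E(\cdot\mid\omega)=\delta_\omega$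 for all $\omega$. Let $$\mathcal V:=\frac{1-q}{q}\,\frac{1-\mathcal U}{\mathcal U}.$$ Proposition. There is a best equilibrium for the judge in which the expert is truthful, and the quack's strategies $F_Q$ in such equilibria are as follows. (1) (Lemon-dropping.) Suppose $\mathcal V\ge\bar\epsilon$. If $\mathcal V(1-2\bar\epsilon)<\bar\epsilon$, that is, $\mathcal V\in[\bar\epsilon,\frac{\bar\epsilon}{1-2\bar\epsilon})$ (with upper end $+\infty$ if $\bar\epsilon=1/2$), then $F_Q$ is the uniform distribution on $[-\bar m,\bar m]$ with $\bar m=\bar\epsilon/\mathcal V$, and no other $F_Q$ occurs. If $\mathcal V(1-2\bar\epsilon)\ge\bar\epsilon$, that is, $\mathcal V\ge\frac{\bar\epsilon}{1-2\bar\epsilon}$, then, for $\bar m\in(0,1]$, the uniform distribution on $[-\bar m,\bar m]$ is the quack's strategy in some best equilibrium with a truthful expert if and only if $\bar m\in[\bar\epsilon/\mathcal V,\,1-2\bar\epsilon]$. (2) (Cherry-picking.) Suppose $\mathcal V<\bar\epsilon$. Then the equation $$\frac1{\bar\epsilon}-\frac1{\mathcal V}=2z-2\tanh^{-1}(z)$$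 has a unique solution $z\in(0,1)$, and $F_Q$ is the distribution on $[-1,1]$ with density $$f_Q(m)=\begin{cases}\dfrac{\mathcal V}{2\bar\epsilon}, & |m|\le 1-2\bar\epsilon z,\\[2mm] \dfrac{\mathcal V}{\sqrt{(1-|m|)^2+4\bar\epsilon^2(1-z^2)}}, & |m|\ge 1-2\bar\epsilon z,\end{cases}$$ and no other $F_Q$ occurs. -/

import Mathlib

open MeasureTheory ProbabilityTheory Set
open scoped ENNReal

noncomputable section

namespace OneSpeaker

/-- The interval `[-1, 1]`, which is both the state space and the message space. -/
abbrev Pt : Type := Icc (-1 : ℝ) 1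

/-- The uniform distribution on the real interval `[a, b]` (for `a < b`). -/
def uniform (a b : ℝ) : Measure ℝ := ProbabilityTheory.cond volume (Icc a b)

/-- The state is uniform on `[-1, 1]`. -/
def prior : Measure Pt := (uniform (-1) 1).comap Subtype.val

/-- The noise in the judge's signal is uniform on `[-eps, eps]`. -/
def noise (eps : ℝ) : Measure ℝ := uniform (-eps) eps

/-- Strategies of the two types of the speaker and of the judge, and the judge's beliefs.
The expert's message is drawn from `expert ω` in state `ω`, the quack's message from `quack`.
After message `m` and signal `s`, the judge selects the speaker with probability `select m s`
(and takes the outside option otherwise), and assigns probability `belief m s` to the event that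
the speaker is an expert. -/
structure Assessment where
  expert : Kernel Pt Pt
  expert_markov : IsMarkovKernel expert
  quack : Measure Pt
  quack_prob : IsProbabilityMeasure quack
  select : Pt → ℝ → ℝ
  select_meas : Measurable (Function.uncurry select)
  select_mem : ∀ m s, select m s ∈ Icc (0 : ℝ) 1
  belief : Pt → ℝ → ℝ
  belief_meas : Measurable (Function.uncurry belief)
  belief_mem : ∀ m s, belief m s ∈ Icc (0 : ℝ) 1

namespace Assessment

/-- The probability that the speaker is selected if the state is `ω` and he sends `m`;
the signal is `ω` plus noise. -/
def selectProb (A : Assessment) (eps : ℝ) (ω m : Pt) : ℝ :=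
  ∫ x, A.select m ((ω : ℝ) + x) ∂(noise eps)

/-- The joint law of message and signal if the speaker is an expert. -/
def expertLaw (A : Assessment) (eps : ℝ) : Measure (Pt × ℝ) :=
  ((prior.compProd A.expert).prod (noise eps)).map
    fun x : (Pt × Pt) × ℝ => (x.1.2, (x.1.1 : ℝ) + x.2)

/-- The joint law of message and signal if the speaker is a quack: his message is independent of
the state. -/
def quackLaw (A : Assessment) (eps : ℝ) : Measure (Pt × ℝ) :=
  ((prior.prod A.quack).prod (noise eps)).map
    fun x : (Pt × Pt) × ℝ => (x.1.2, (x.1.1 : ℝ) + x.2)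

/-- The joint law of message and signal from the judge's point of view. -/
def observedLaw (A : Assessment) (q eps : ℝ) : Measure (Pt × ℝ) :=
  ENNReal.ofReal (1 - q) • A.expertLaw eps + ENNReal.ofReal q • A.quackLaw eps

/-- Perfect Bayesian equilibrium when the speaker is a quack with probability `q`, the outside
option is worth `U` and the noise is uniform on `[-eps, eps]`. -/
structure IsPBE (A : Assessment) (q U eps : ℝ) : Prop where
  /-- In every state, no message gives the expert a higher probability of selection. -/
  expert_opt : ∀ ω m : Pt, A.selectProb eps ω m ≤ ∫ m', A.selectProb eps ω m' ∂(A.expert ω)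
  /-- No message gives the quack, who does not know the state, a higher probability of
  selection. -/
  quack_opt : ∀ m : Pt, ∫ ω, A.selectProb eps ω m ∂prior ≤
    ∫ m', (∫ ω, A.selectProb eps ω m' ∂prior) ∂A.quack
  /-- The judge's beliefs are a version of the conditional probability, given message and signal,
  that the speaker is an expert. -/
  bayes : ∀ B : Set (Pt × ℝ), MeasurableSet B →
    ∫ x in B, A.belief x.1 x.2 ∂(A.observedLaw q eps) = (1 - q) * (A.expertLaw eps).real B
  /-- The judge's selection is optimal after every message and signal, given her beliefs:
  selecting the speaker is worth the probability that he is an expert. -/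
  judge_select : ∀ m s, U < A.belief m s → A.select m s = 1
  judge_reject : ∀ m s, A.belief m s < U → A.select m s = 0

/-- The judge's expected payoff: `1` if she selects an expert, `0` if she selects a quack, and `U`
if she takes the outside option. -/
def judgePayoff (A : Assessment) (q U eps : ℝ) : ℝ :=
  (1 - q) * ∫ x, (A.select x.1 x.2 + (1 - A.select x.1 x.2) * U) ∂(A.expertLaw eps) +
    q * ∫ x, (1 - A.select x.1 x.2) * U ∂(A.quackLaw eps)

/-- An equilibrium that gives the judge the highest payoff among all equilibria. -/
def IsBest (A : Assessment) (q U eps : ℝ) : Prop :=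
  A.IsPBE q U eps ∧ ∀ B : Assessment, B.IsPBE q U eps → B.judgePayoff q U eps ≤ A.judgePayoff q U eps

/-- The expert reports the state. -/
def Truthful (A : Assessment) : Prop := ∀ ω : Pt, A.expert ω = Measure.dirac ω

/-- The quack's messaging strategy as a probability distribution on the real line. -/
def quackDist (A : Assessment) : Measure ℝ := A.quack.map Subtype.val

end Assessment

/-- `F` is the quack's messaging strategy in some best equilibrium for the judge in which the expert
is truthful. -/
def IsBestQuack (q U eps : ℝ) (F : Measure ℝ) : Prop :=
  ∃ A : Assessment, A.IsBest q U eps ∧ A.Truthful ∧ A.quackDist = F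

/-- The quack's density in the cherry-picking setting. -/
def cherryDensity (V eps z m : ℝ) : ℝ :=
  if |m| ≤ 1 - 2 * eps * z then V / (2 * eps)
  else V / √((1 - |m|) ^ 2 + 4 * eps ^ 2 * (1 - z ^ 2))

/-- The distribution on `[-1, 1]` with density `cherryDensity`. -/
def cherryDist (V eps z : ℝ) : Measure ℝ :=
  (volume.restrict (Icc (-1 : ℝ) 1)).withDensity fun m => ENNReal.ofReal (cherryDensity V eps z m)

end OneSpeaker

end

noncomputable section

namespace OneSpeaker

/-! Up to positive affine rescaling, the judge's payoff is `gain`: `V` times the probability that an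
expert is selected, minus the probability that a quack is. The judge maximizes it and the quack
minimizes it, so once the expert is truthful the two of them play a zero-sum game.

This yields two facts. Every truthful equilibrium is best (`isBest_of_truthful`): its judge could
garble each message through the expert's strategy of any other equilibrium and then follow that
equilibrium's rule, and the quack there could have imitated a garbled state. Truthful equilibria are
moreover interchangeable (`interchange`), so one of them constrains the quack's strategy in all
others. It remains to construct one truthful equilibrium in each regime and to exploit its selection
rule.

Let `g` be the density of the signal. On `|s - m| ≤ e` a truthful expert has joint density `1/(4e)`
and a quack with density `f` has `f m * g s`, so the judge selects when `f m * g s < V/(4e)` and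
rejects when the inequality is reversed. Such a likelihood ratio rule, if it gives the quack the
same probability `lam` on his support and no more elsewhere, also makes truth optimal for the
expert, by a Neyman-Pearson comparison (`exists_truthful_isPBE`). The rules used select, for `m ≥
0`, the upper part of probability `lam` of the signals near `m` (the less likely signals), and are
reflected for `m < 0`.

For uniqueness, not selecting on a set where the rule selects cannot help the judge. Applied just
above a signal of indifference, this bounds the density of every quack strategy
(`le_withDensity_of_gain_le`), while equality of the quack's payoffs confines its support
(`quack_of_cutoff_equilibrium`). When the bound restricted to the support has mass 1, it determines
the strategy. In lemon-dropping the bound is the constant `V/(2e)`; in cherry-picking it is `V /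
cherryRoot`, whose total mass is 1 exactly by the equation for `z`. -/

/-! ### Laws of the state, the noise and the signal. -/

theorem uniform_eq {a b : ℝ} (h : a < b) :
    uniform a b = ENNReal.ofReal (1 / (b - a)) • volume.restrict (Icc a b) := by
  have h' : 0 < b - a := sub_pos.2 h
  rw [uniform, ProbabilityTheory.cond, Real.volume_Icc, one_div, ENNReal.ofReal_inv_of_pos h']

theorem isProbabilityMeasure_uniform {a b : ℝ} (h : a < b) :
    IsProbabilityMeasure (uniform a b) := by
  have : volume (Icc a b) ≠ 0 := by simp [h]
  exact cond_isProbabilityMeasure_of_finite this (by simp)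

/-- Lebesgue measure on `[-1, 1]`. -/
def lebPt : Measure Pt := (volume : Measure ℝ).comap Subtype.val

theorem map_val_lebPt : lebPt.map Subtype.val = volume.restrict (Icc (-1 : ℝ) 1) :=
  map_comap_subtype_coe measurableSet_Icc _

theorem lintegral_lebPt (f : ℝ → ℝ≥0∞) :
    ∫⁻ x : Pt, f x ∂lebPt = ∫⁻ x in Icc (-1 : ℝ) 1, f x := by
  rw [← map_val_lebPt, (MeasurableEmbedding.subtype_coe measurableSet_Icc).lintegral_map]

theorem prior_eq : prior = ENNReal.ofReal (1 / 2) • lebPt := by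
  have h : (1 : ℝ) - -1 = 2 := by norm_num
  have hv := MeasurableEmbedding.subtype_coe (measurableSet_Icc (a := (-1 : ℝ)) (b := 1))
  ext s hs
  rw [prior, uniform_eq (by norm_num), h, hv.comap_apply, Measure.smul_apply, Measure.smul_apply,
    Measure.restrict_apply (hv.measurableSet_image.2 hs),
    inter_eq_self_of_subset_left (by rintro _ ⟨x, -, rfl⟩; exact x.2), lebPt, hv.comap_apply]

theorem lebPt_univ : lebPt univ = ENNReal.ofReal 2 := by
  have h := lintegral_lebPt 1
  simp only [Pi.one_apply, lintegral_one, Measure.restrict_apply_univ, Real.volume_Icc] at h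
  rw [h]; norm_num

instance : IsFiniteMeasure lebPt := ⟨by simp [lebPt_univ]⟩

instance : IsProbabilityMeasure prior := by
  constructor
  rw [prior_eq, Measure.smul_apply, lebPt_univ, smul_eq_mul, ← ENNReal.ofReal_mul (by norm_num)]
  norm_num

theorem noise_eq {e : ℝ} (he : 0 < e) :
    noise e = ENNReal.ofReal (1 / (2 * e)) • volume.restrict (Icc (-e) e) := by
  rw [noise, uniform_eq (by linarith), sub_neg_eq_add, two_mul]

theorem isProbabilityMeasure_noise {e : ℝ} (he : 0 < e) : IsProbabilityMeasure (noise e) :=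
  isProbabilityMeasure_uniform (by linarith)

theorem map_noise {e : ℝ} (he : 0 < e) (w : ℝ) :
    (noise e).map (w + ·) =
      ENNReal.ofReal (1 / (2 * e)) • volume.restrict (Icc (w - e) (w + e)) := by
  have h : Icc (-e) e = (w + ·) ⁻¹' Icc (w - e) (w + e) := by
    ext x; simp only [mem_Icc, mem_preimage]; constructor <;> rintro ⟨h1, h2⟩ <;>
      constructor <;> linarith
  rw [noise_eq he, Measure.map_smul, h,
    (measurePreserving_add_left (volume : Measure ℝ) w).restrict_preimage measurableSet_Icc |>.map_eq]

theorem lintegral_noise {e : ℝ} (he : 0 < e) (w : ℝ) {h : ℝ → ℝ≥0∞} (hh : Measurable h) :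
    ∫⁻ x, h (w + x) ∂noise e =
      ENNReal.ofReal (1 / (2 * e)) * ∫⁻ s in Icc (w - e) (w + e), h s := by
  rw [← lintegral_map (μ := noise e) hh (measurable_const_add w), map_noise he,
    lintegral_smul_measure, smul_eq_mul]

theorem integral_noise {e : ℝ} (he : 0 < e) (w : ℝ) {h : ℝ → ℝ} (hh : Measurable h) :
    ∫ x, h (w + x) ∂noise e = 1 / (2 * e) * ∫ s in Icc (w - e) (w + e), h s := by
  rw [← integral_map (μ := noise e) (measurable_const_add w).aemeasurable
    hh.aestronglyMeasurable, map_noise he, integral_smul_measure,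
    ENNReal.toReal_ofReal (by positivity), smul_eq_mul]

/-- The density of the judge's signal. -/
def signalDensity (e s : ℝ) : ℝ := max 0 (min 1 (s + e) - max (-1) (s - e)) / (4 * e)

theorem continuous_signalDensity (e : ℝ) : Continuous (signalDensity e) := by
  unfold signalDensity; fun_prop

theorem signalDensity_nonneg {e : ℝ} (he : 0 < e) (s : ℝ) : 0 ≤ signalDensity e s := by
  unfold signalDensity; positivity

theorem signalDensity_neg (e s : ℝ) : signalDensity e (-s) = signalDensity e s := by
  have h : min 1 (-s + e) - max (-1) (-s - e) = min 1 (s + e) - max (-1) (s - e) := by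
    have h1 : max (-1) (-s - e) = - min 1 (s + e) := by
      rw [← max_neg_neg]; congr 1; ring
    have h2 : min 1 (-s + e) = - max (-1) (s - e) := by
      rw [← min_neg_neg]; congr 1 <;> ring
    rw [h1, h2]; ring
  rw [signalDensity, signalDensity, h]

theorem signalDensity_eq {e s : ℝ} (he : 0 < e) (h1 : -(1 - e) ≤ s)
    (h2 : s ≤ 1 + e) : signalDensity e s = 1 / 2 - max (s - (1 - e)) 0 / (4 * e) := by
  have h3 : max (-1) (s - e) = s - e := max_eq_right (by linarith)
  have h4 : max 0 (min 1 (s + e) - (s - e)) = min 1 (s + e) - (s - e) :=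
    max_eq_right (by rw [sub_nonneg]; exact le_min (by linarith) (by linarith))
  rw [signalDensity, h3, h4]
  rcases le_total s (1 - e) with h | h
  · rw [min_eq_right (by linarith), max_eq_right (by linarith)]; field_simp; ring
  · rw [min_eq_left (by linarith), max_eq_left (by linarith)]; field_simp; ring

theorem signalDensity_le {e : ℝ} (he : 0 < e) (s : ℝ) : signalDensity e s ≤ 1 / 2 := by
  rw [signalDensity, div_le_iff₀ (by positivity)]
  apply max_le (by linarith)
  linarith [min_le_right 1 (s + e), le_max_right (-1) (s - e)]

/-- The law of the judge's signal. -/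
def signalLaw (e : ℝ) : Measure ℝ :=
  (prior.prod (noise e)).map fun p => (p.1 : ℝ) + p.2

theorem measurable_val_add : Measurable fun p : Pt × ℝ => (p.1 : ℝ) + p.2 := by fun_prop

theorem isProbabilityMeasure_signalLaw {e : ℝ} (he : 0 < e) :
    IsProbabilityMeasure (signalLaw e) := by
  have := isProbabilityMeasure_noise he
  exact Measure.isProbabilityMeasure_map measurable_val_add.aemeasurable

/-- Tonelli, with the symmetry that `s` is within `e` of `w` if and only if `w` is within `e` of
`s`: the density at `s` is the length of the set of states compatible with `s`, divided by `4e`. -/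
theorem lintegral_signalLaw {e : ℝ} (he : 0 < e) {h : ℝ → ℝ≥0∞} (hh : Measurable h) :
    ∫⁻ s, h s ∂signalLaw e = ∫⁻ s, ENNReal.ofReal (signalDensity e s) * h s := by
  have := isProbabilityMeasure_noise he
  have hI : ∀ (w s : ℝ), (Icc (w - e) (w + e)).indicator h s =
      h s * (Icc (s - e) (s + e)).indicator 1 w := by
    intro w s
    have : s ∈ Icc (w - e) (w + e) ↔ w ∈ Icc (s - e) (s + e) := by
      simp only [mem_Icc]; constructor <;> rintro ⟨h1, h2⟩ <;> constructor <;> linarith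
    by_cases hs : s ∈ Icc (w - e) (w + e)
    · simp [hs, this.1 hs]
    · simp [hs, mt this.2 hs]
  have hm : Measurable fun p : ℝ × ℝ => (Icc (p.2 - e) (p.2 + e)).indicator (1 : ℝ → ℝ≥0∞) p.1 := by
    have : MeasurableSet {p : ℝ × ℝ | p.2 - e ≤ p.1 ∧ p.1 ≤ p.2 + e} :=
      (measurableSet_le (measurable_snd.sub_const e) measurable_fst).inter
        (measurableSet_le measurable_fst (measurable_snd.add_const e))
    exact measurable_const.indicator this
  calc ∫⁻ s, h s ∂signalLaw e
      = ∫⁻ w, ∫⁻ x, h (w + x) ∂noise e ∂prior := by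
        rw [signalLaw, lintegral_map hh measurable_val_add, lintegral_prod _ (by fun_prop)]
    _ = ENNReal.ofReal (1 / (4 * e)) *
          ∫⁻ w in Icc (-1 : ℝ) 1, ∫⁻ s, h s * (Icc (s - e) (s + e)).indicator 1 w := by
        simp_rw [lintegral_noise he _ hh]
        rw [prior_eq, lintegral_smul_measure, lintegral_lebPt (fun w => ENNReal.ofReal (1 / (2 * e)) *
          ∫⁻ s in Icc (w - e) (w + e), h s), lintegral_const_mul', smul_eq_mul, ← mul_assoc,
          ← ENNReal.ofReal_mul (by norm_num)]
        · congr 2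
          · field_simp; norm_num
          · ext w
            rw [← lintegral_indicator measurableSet_Icc]
            exact lintegral_congr (hI w)
        · exact ENNReal.ofReal_ne_top
    _ = ENNReal.ofReal (1 / (4 * e)) *
          ∫⁻ s, h s * volume (Icc (s - e) (s + e) ∩ Icc (-1 : ℝ) 1) := by
        rw [lintegral_lintegral_swap]
        · congr 2; ext s
          rw [lintegral_const_mul _ (measurable_one.indicator measurableSet_Icc),
            lintegral_indicator_one measurableSet_Icc, Measure.restrict_apply measurableSet_Icc]
        · exact ((hh.comp measurable_snd).mul hm).aemeasurable
    _ = _ := by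
        rw [← lintegral_const_mul' _ _ ENNReal.ofReal_ne_top]
        refine lintegral_congr fun s => ?_
        rw [Icc_inter_Icc, Real.volume_Icc, mul_comm (h s), ← mul_assoc,
          ← ENNReal.ofReal_mul (by positivity), signalDensity, one_div_mul_eq_div,
          min_comm (s + e), max_comm (s - e), ← max_div_div_right (by positivity : 0 ≤ 4 * e),
          zero_div, ENNReal.ofReal_max, ENNReal.ofReal_zero, max_eq_right zero_le]

theorem signalLaw_eq {e : ℝ} (he : 0 < e) :
    signalLaw e = volume.withDensity fun s => ENNReal.ofReal (signalDensity e s) := by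
  refine Measure.ext_of_lintegral _ fun h hh => ?_
  rw [lintegral_signalLaw he hh, lintegral_withDensity_eq_lintegral_mul _
    (continuous_signalDensity e).measurable.ennreal_ofReal hh]
  rfl

/-! ### Selection rules and joint laws of message and signal. -/

/-- The joint law of the state and the signal, which is that of message and signal when the speaker
is a truthful expert. -/
def truthLaw (e : ℝ) : Measure (Pt × ℝ) :=
  (prior.prod (noise e)).map fun p => (p.1, (p.1 : ℝ) + p.2)

/-- A measurable selection rule of the judge. -/
structure IsRule (φ : Pt → ℝ → ℝ) : Prop where
  meas : Measurable (Function.uncurry φ)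
  mem : ∀ m s, φ m s ∈ Icc (0 : ℝ) 1

theorem Assessment.isRule (A : Assessment) : IsRule A.select := ⟨A.select_meas, A.select_mem⟩

theorem IsRule.integrable {φ : Pt → ℝ → ℝ} (h : IsRule φ) (μ : Measure (Pt × ℝ))
    [IsFiniteMeasure μ] : Integrable (fun x => φ x.1 x.2) μ :=
  Integrable.of_bound h.meas.aestronglyMeasurable 1
    (ae_of_all _ fun x => by
      rw [Real.norm_eq_abs, abs_of_nonneg (h.mem _ _).1]; exact (h.mem _ _).2)

theorem IsRule.integrable_comp {φ : Pt → ℝ → ℝ} (h : IsRule φ) {α : Type*} [MeasurableSpace α]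
    (μ : Measure α) [IsFiniteMeasure μ] {f : α → Pt} {g : α → ℝ} (hf : Measurable f)
    (hg : Measurable g) : Integrable (fun x => φ (f x) (g x)) μ :=
  Integrable.of_bound (h.meas.comp (hf.prodMk hg)).aestronglyMeasurable 1
    (ae_of_all _ fun x => by
      rw [Real.norm_eq_abs, abs_of_nonneg (h.mem _ _).1]; exact (h.mem _ _).2)

theorem isProbabilityMeasure_truthLaw {e : ℝ} (he : 0 < e) :
    IsProbabilityMeasure (truthLaw e) := by
  have := isProbabilityMeasure_noise he
  exact Measure.isProbabilityMeasure_map (by fun_prop)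

/-- The probability that a message which is independent of the state is selected. -/
def pooledProb (φ : Pt → ℝ → ℝ) (e : ℝ) (m : Pt) : ℝ := ∫ s, φ m s ∂signalLaw e

theorem pooledProb_eq {φ : Pt → ℝ → ℝ} (h : IsRule φ) {e : ℝ} (he : 0 < e) (m : Pt) :
    pooledProb φ e m = ∫ w : Pt, ∫ x, φ m ((w : ℝ) + x) ∂noise e ∂prior := by
  have := isProbabilityMeasure_noise he
  rw [pooledProb, signalLaw, integral_map (f := φ m) measurable_val_add.aemeasurable
    (h.meas.comp measurable_prodMk_left).aestronglyMeasurable,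
    integral_prod _ (h.integrable_comp _ measurable_const measurable_val_add)]

theorem measurable_pooledProb {φ : Pt → ℝ → ℝ} (h : IsRule φ) {e : ℝ} (he : 0 < e) :
    Measurable (pooledProb φ e) := by
  have := isProbabilityMeasure_signalLaw he
  exact (h.meas.stronglyMeasurable.integral_prod_right (ν := signalLaw e)).measurable

theorem pooledProb_mem {φ : Pt → ℝ → ℝ} (h : IsRule φ) {e : ℝ} (he : 0 < e) (m : Pt) :
    pooledProb φ e m ∈ Icc (0 : ℝ) 1 := by
  have := isProbabilityMeasure_signalLaw he
  refine ⟨integral_nonneg fun s => (h.mem m s).1, ?_⟩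
  have := integral_mono (μ := signalLaw e) (h.integrable_comp _ measurable_const measurable_id)
    (integrable_const 1) (fun s => (h.mem m s).2)
  simpa [pooledProb] using this

theorem integrable_pooledProb {φ : Pt → ℝ → ℝ} (h : IsRule φ) {e : ℝ} (he : 0 < e)
    (Q : Measure Pt) [IsFiniteMeasure Q] : Integrable (pooledProb φ e) Q :=
  Integrable.of_bound (measurable_pooledProb h he).aestronglyMeasurable 1
    (ae_of_all _ fun x => by
      rw [Real.norm_eq_abs, abs_of_nonneg (pooledProb_mem h he _).1]
      exact (pooledProb_mem h he _).2)

theorem integral_prod_signalLaw {φ : Pt → ℝ → ℝ} (h : IsRule φ) {e : ℝ} (he : 0 < e)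
    (Q : Measure Pt) [IsFiniteMeasure Q] :
    ∫ x, φ x.1 x.2 ∂Q.prod (signalLaw e) = ∫ m, pooledProb φ e m ∂Q := by
  have := isProbabilityMeasure_signalLaw he
  exact integral_prod _ (h.integrable _)

theorem integral_truthLaw {φ : Pt → ℝ → ℝ} (h : IsRule φ) {e : ℝ} (he : 0 < e) :
    ∫ x, φ x.1 x.2 ∂truthLaw e = ∫ w : Pt, ∫ x, φ w ((w : ℝ) + x) ∂noise e ∂prior := by
  have := isProbabilityMeasure_noise he
  rw [truthLaw, integral_map (by fun_prop) (h.meas.aestronglyMeasurable.congr (by rfl)),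
    integral_prod _ (h.integrable_comp _ measurable_fst measurable_val_add)]

theorem isProbabilityMeasure_expertLaw (A : Assessment) {e : ℝ} (he : 0 < e) :
    IsProbabilityMeasure (A.expertLaw e) := by
  have := isProbabilityMeasure_noise he
  have := A.expert_markov
  exact Measure.isProbabilityMeasure_map (by fun_prop)

theorem quackLaw_eq (A : Assessment) {e : ℝ} (he : 0 < e) :
    A.quackLaw e = A.quack.prod (signalLaw e) := by
  have := isProbabilityMeasure_noise he
  have := isProbabilityMeasure_signalLaw he
  have := A.quack_prob
  have hm : Measurable fun x : (Pt × Pt) × ℝ => (x.1.2, (x.1.1 : ℝ) + x.2) := by fun_prop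
  refine Measure.ext_of_lintegral _ fun h hh => ?_
  rw [Assessment.quackLaw, lintegral_map hh hm, lintegral_prod _ (by fun_prop),
    lintegral_prod_symm _ (Measurable.lintegral_prod_right' (f := fun x : (Pt × Pt) × ℝ =>
      h (x.1.2, (x.1.1 : ℝ) + x.2)) (by fun_prop)).aemeasurable, lintegral_prod _ hh.aemeasurable]
  refine lintegral_congr fun m => ?_
  rw [signalLaw, lintegral_map (by fun_prop) measurable_val_add, lintegral_prod _ (by fun_prop)]

theorem isProbabilityMeasure_quackLaw (A : Assessment) {e : ℝ} (he : 0 < e) :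
    IsProbabilityMeasure (A.quackLaw e) := by
  have := isProbabilityMeasure_signalLaw he
  have := A.quack_prob
  rw [quackLaw_eq A he]; infer_instance

theorem integral_expertLaw (A : Assessment) {φ : Pt → ℝ → ℝ} (h : IsRule φ) {e : ℝ} (he : 0 < e) :
    ∫ x, φ x.1 x.2 ∂A.expertLaw e =
      ∫ w : Pt, ∫ m, ∫ x, φ m ((w : ℝ) + x) ∂noise e ∂A.expert w ∂prior := by
  have := isProbabilityMeasure_noise he
  have := A.expert_markov
  have hi : Integrable (fun x : (Pt × Pt) × ℝ => φ x.1.2 ((x.1.1 : ℝ) + x.2))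
    ((prior.compProd A.expert).prod (noise e)) := h.integrable_comp _ (by fun_prop) (by fun_prop)
  rw [Assessment.expertLaw, integral_map (by fun_prop) (h.meas.aestronglyMeasurable.congr (by rfl)),
    integral_prod _ hi, Measure.integral_compProd hi.integral_prod_left]

theorem expertLaw_eq_of_truthful (A : Assessment) (hA : A.Truthful) {e : ℝ} (he : 0 < e) :
    A.expertLaw e = truthLaw e := by
  have := isProbabilityMeasure_noise he
  have := A.expert_markov
  refine Measure.ext_of_lintegral _ fun h hh => ?_
  rw [Assessment.expertLaw, lintegral_map hh (by fun_prop), lintegral_prod _ (by fun_prop),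
    Measure.lintegral_compProd (Measurable.lintegral_prod_right' (f := fun x : (Pt × Pt) × ℝ =>
      h (x.1.2, (x.1.1 : ℝ) + x.2)) (by fun_prop)), truthLaw, lintegral_map hh (by fun_prop),
    lintegral_prod _ (by fun_prop)]
  refine lintegral_congr fun w => ?_
  rw [hA w, lintegral_dirac]

/-! ### The judge's objective and deviations of the quack. -/

/-- The judge's gain from the rule `φ`, relative to the outside option and in units of the loss from
selecting a quack, if the messages of experts and quacks have the given laws. -/
def gain (V : ℝ) (φ : Pt → ℝ → ℝ) (μ ν : Measure (Pt × ℝ)) : ℝ :=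
  V * ∫ x, φ x.1 x.2 ∂μ - ∫ x, φ x.1 x.2 ∂ν

/-- Bayes' rule says that the belief is the density of the expert part of the observed law, so it
can be integrated against any function, not only indicators. -/
theorem integral_belief_mul {A : Assessment} {q U e : ℝ} (he : 0 < e)
    (hq1 : q < 1) (hA : A.IsPBE q U e) (φ : Pt → ℝ → ℝ) :
    ∫ x, A.belief x.1 x.2 * φ x.1 x.2 ∂A.observedLaw q e =
      (1 - q) * ∫ x, φ x.1 x.2 ∂A.expertLaw e := by
  have := isProbabilityMeasure_expertLaw A he
  have := isProbabilityMeasure_quackLaw A he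
  have hfin : IsFiniteMeasure (A.observedLaw q e) := by
    have h1 := Measure.smul_finite (A.expertLaw e) (c := ENNReal.ofReal (1 - q)) (by simp)
    have h2 := Measure.smul_finite (A.quackLaw e) (c := ENNReal.ofReal q) (by simp)
    unfold Assessment.observedLaw; infer_instance
  have hb : IsRule A.belief := ⟨A.belief_meas, A.belief_mem⟩
  have hm : Measurable fun x : Pt × ℝ => ENNReal.ofReal (A.belief x.1 x.2) :=
    A.belief_meas.ennreal_ofReal
  have hE : (A.observedLaw q e).withDensity (fun x => ENNReal.ofReal (A.belief x.1 x.2)) =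
      ENNReal.ofReal (1 - q) • A.expertLaw e := by
    ext B hB
    rw [withDensity_apply _ hB, ← ofReal_integral_eq_lintegral_ofReal
      (hb.integrable _).integrableOn (ae_of_all _ fun x => (A.belief_mem _ _).1),
      hA.bayes B hB, ENNReal.ofReal_mul (by linarith), Measure.real,
      ENNReal.ofReal_toReal (measure_ne_top _ _)]
    rfl
  have h2 := integral_withDensity_eq_integral_toReal_smul (μ := A.observedLaw q e) hm
    (ae_of_all _ fun x => ENNReal.ofReal_lt_top) (fun x => φ x.1 x.2)
  rw [hE, integral_smul_measure, ENNReal.toReal_ofReal (by linarith), smul_eq_mul] at h2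
  rw [h2]
  refine integral_congr_ae (ae_of_all _ fun x => ?_)
  simp only [smul_eq_mul]
  rw [ENNReal.toReal_ofReal (A.belief_mem _ _).1]

/-- Interim optimality of the judge implies ex ante optimality. -/
theorem gain_le_of_isPBE {A : Assessment} {q U e V : ℝ} (he : 0 < e) (hq0 : 0 < q)
    (hq1 : q < 1) (hU0 : 0 < U) (hV : V = (1 - q) / q * ((1 - U) / U)) (hA : A.IsPBE q U e)
    {φ : Pt → ℝ → ℝ} (hφ : IsRule φ) :
    gain V φ (A.expertLaw e) (A.quackLaw e) ≤ gain V A.select (A.expertLaw e) (A.quackLaw e) := by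
  have := isProbabilityMeasure_expertLaw A he
  have := isProbabilityMeasure_quackLaw A he
  have h1 := Measure.smul_finite (A.expertLaw e) (c := ENNReal.ofReal (1 - q)) (by simp)
  have h2 := Measure.smul_finite (A.quackLaw e) (c := ENNReal.ofReal q) (by simp)
  have hfin : IsFiniteMeasure (A.observedLaw q e) := by
    unfold Assessment.observedLaw; infer_instance
  have hb : IsRule A.belief := ⟨A.belief_meas, A.belief_mem⟩
  have hint : ∀ ψ : Pt → ℝ → ℝ, IsRule ψ →
      Integrable (fun x => A.belief x.1 x.2 * ψ x.1 x.2) (A.observedLaw q e) := fun ψ hψ =>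
    (hψ.integrable _).bdd_mul (c := 1) A.belief_meas.aestronglyMeasurable (ae_of_all _ fun x => by
      change |A.belief x.1 x.2| ≤ 1
      rw [abs_of_nonneg (A.belief_mem _ _).1]
      exact (A.belief_mem _ _).2)
  -- Ex ante gain is the mean of (belief minus `U`) times the selection probability; the equilibrium
  -- rule maximizes this integrand pointwise.
  have key : ∀ ψ : Pt → ℝ → ℝ, IsRule ψ →
      ∫ x, (A.belief x.1 x.2 * ψ x.1 x.2 - U * ψ x.1 x.2) ∂A.observedLaw q e =
        q * U * gain V ψ (A.expertLaw e) (A.quackLaw e) := by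
    intro ψ hψ
    rw [integral_sub (hint ψ hψ) ((hψ.integrable _).const_mul U), integral_belief_mul he hq1 hA,
      integral_const_mul, Assessment.observedLaw,
      integral_add_measure (hψ.integrable _) (hψ.integrable _), integral_smul_measure,
      integral_smul_measure, ENNReal.toReal_ofReal (by linarith), ENNReal.toReal_ofReal hq0.le,
      gain, hV, smul_eq_mul, smul_eq_mul]
    field_simp
    ring
  have hle : ∫ x, (A.belief x.1 x.2 * φ x.1 x.2 - U * φ x.1 x.2) ∂A.observedLaw q e ≤
      ∫ x, (A.belief x.1 x.2 * A.select x.1 x.2 - U * A.select x.1 x.2) ∂A.observedLaw q e := by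
    refine integral_mono ((hint φ hφ).sub ((hφ.integrable _).const_mul U))
      ((hint _ A.isRule).sub ((A.isRule.integrable _).const_mul U)) fun x => ?_
    have hx := hφ.mem x.1 x.2
    rcases lt_trichotomy (A.belief x.1 x.2) U with h | h | h
    · simp only [hA.judge_reject _ _ h]
      nlinarith [hx.1]
    · simp only [h, sub_self, le_refl]
    · simp only [hA.judge_select _ _ h]
      nlinarith [hx.2]
  rw [key φ hφ, key _ A.isRule] at hle
  exact le_of_mul_le_mul_left hle (by positivity)

theorem judgePayoff_eq (A : Assessment) {q U e V : ℝ} (he : 0 < e) (hq0 : 0 < q)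
    (hU0 : 0 < U) (hV : V = (1 - q) / q * ((1 - U) / U)) :
    A.judgePayoff q U e = U + q * U * gain V A.select (A.expertLaw e) (A.quackLaw e) := by
  have := isProbabilityMeasure_expertLaw A he
  have := isProbabilityMeasure_quackLaw A he
  have h : ∀ (μ : Measure (Pt × ℝ)) [IsProbabilityMeasure μ],
      ∫ x, (1 - A.select x.1 x.2) * U ∂μ = U - U * ∫ x, A.select x.1 x.2 ∂μ := fun μ _ => by
    rw [integral_mul_const, integral_sub (integrable_const _) (A.isRule.integrable _)]
    simp; ring
  have hi : Integrable (fun x => (1 - A.select x.1 x.2) * U) (A.expertLaw e) :=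
    ((integrable_const _).sub (A.isRule.integrable _)).mul_const U
  rw [Assessment.judgePayoff, integral_add (A.isRule.integrable _) hi, h, h, gain, hV]
  field_simp
  ring

theorem quack_deviation {A : Assessment} {q U e : ℝ} (he : 0 < e) (hA : A.IsPBE q U e) (m : Pt) :
    pooledProb A.select e m ≤ ∫ x, A.select x.1 x.2 ∂A.quackLaw e := by
  have := A.quack_prob
  have h := hA.quack_opt m
  simp only [Assessment.selectProb, ← pooledProb_eq A.isRule he] at h
  rwa [quackLaw_eq A he, integral_prod_signalLaw A.isRule he]

theorem quack_deviation_mixed {A : Assessment} {q U e : ℝ} (he : 0 < e) (hA : A.IsPBE q U e)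
    (Q : Measure Pt) [IsProbabilityMeasure Q] :
    ∫ x, A.select x.1 x.2 ∂Q.prod (signalLaw e) ≤ ∫ x, A.select x.1 x.2 ∂A.quackLaw e := by
  rw [integral_prod_signalLaw A.isRule he]
  have := integral_mono (μ := Q) (integrable_pooledProb A.isRule he Q) (integrable_const _)
    (fun m => quack_deviation he hA m)
  simpa using this

/-! ### Optimality and interchangeability of truthful equilibria. -/

/-- An equilibrium with a truthful expert is best for the judge: against the quack who draws a state
from `A.quack` and then imitates the expert, every equilibrium gives a garbling. -/
theorem isBest_of_truthful {A : Assessment} {q U e V : ℝ} (he : 0 < e) (hq0 : 0 < q)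
    (hq1 : q < 1) (hU0 : 0 < U) (hV : V = (1 - q) / q * ((1 - U) / U))
    (hA : A.IsPBE q U e) (hT : A.Truthful) : A.IsBest q U e := by
  refine ⟨hA, fun B hB => ?_⟩
  have := B.expert_markov
  have := A.quack_prob
  have := isProbabilityMeasure_noise he
  have := isProbabilityMeasure_signalLaw he
  rw [judgePayoff_eq A he hq0 hU0 hV, judgePayoff_eq B he hq0 hU0 hV]
  refine add_le_add_right (mul_le_mul_of_nonneg_left ?_ (by positivity)) U
  -- The judge of `A` reads the message as a state, garbles it by the expert's strategy in `B`, and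
  -- applies the rule of `B`. Against experts this performs as in `B`, and against the quack of `A`
  -- at least as well.
  set φ : Pt → ℝ → ℝ := fun w s => ∫ m, B.select m s ∂B.expert w with hφdef
  have hφ : IsRule φ := by
    constructor
    · have h : StronglyMeasurable (Function.uncurry fun (x : Pt × ℝ) (m : Pt) => B.select m x.2) :=
        (B.select_meas.comp (by fun_prop : Measurable fun y : (Pt × ℝ) × Pt =>
          (y.2, y.1.2))).stronglyMeasurable
      exact (h.integral_kernel_prod_right (κ := B.expert.comap Prod.fst measurable_fst)).measurable
    · intro w s
      refine ⟨integral_nonneg fun m => (B.select_mem m s).1, ?_⟩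
      have := integral_mono (μ := B.expert w)
        (B.isRule.integrable_comp _ measurable_id measurable_const) (integrable_const 1)
        (fun m => (B.select_mem m s).2)
      simpa [hφdef] using this
  refine le_trans ?_ (gain_le_of_isPBE he hq0 hq1 hU0 hV hA hφ)
  rw [gain, gain, expertLaw_eq_of_truthful A hT he, quackLaw_eq A he]
  have h1 : ∫ x, B.select x.1 x.2 ∂B.expertLaw e = ∫ x, φ x.1 x.2 ∂truthLaw e := by
    rw [integral_expertLaw B B.isRule he, integral_truthLaw hφ he]
    refine integral_congr_ae (ae_of_all _ fun w => ?_)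
    exact integral_integral_swap (B.isRule.integrable_comp _ measurable_fst (by fun_prop))
  have h2 : ∫ x, φ x.1 x.2 ∂A.quack.prod (signalLaw e) ≤ ∫ x, B.select x.1 x.2 ∂B.quackLaw e := by
    rw [integral_prod_signalLaw hφ he]
    have h3 : ∀ w, pooledProb φ e w ≤ ∫ x, B.select x.1 x.2 ∂B.quackLaw e := by
      intro w
      have h4 : pooledProb φ e w = ∫ m, pooledProb B.select e m ∂B.expert w :=
        integral_integral_swap (B.isRule.integrable_comp _ measurable_snd measurable_fst)
      have h5 := integral_mono (integrable_pooledProb B.isRule he (B.expert w))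
        (integrable_const _) (fun m => quack_deviation he hB m)
      rw [h4]
      simpa using h5
    have := integral_mono (integrable_pooledProb hφ he A.quack) (integrable_const _) h3
    simpa using this
  rw [h1]
  exact sub_le_sub_left h2 _

theorem isBestQuack_iff {q U e V : ℝ} (he : 0 < e) (hq0 : 0 < q)
    (hq1 : q < 1) (hU0 : 0 < U) (hV : V = (1 - q) / q * ((1 - U) / U))
    (F : Measure ℝ) :
    IsBestQuack q U e F ↔ ∃ A : Assessment, A.IsPBE q U e ∧ A.Truthful ∧ A.quackDist = F := by
  constructor
  · rintro ⟨A, h1, h2, h3⟩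
    exact ⟨A, h1.1, h2, h3⟩
  · rintro ⟨A, h1, h2, h3⟩
    exact ⟨A, isBest_of_truthful he hq0 hq1 hU0 hV h1 h2, h2, h3⟩

/-- Truthful equilibria are interchangeable: the judge's rule in one of them is optimal against the
quack's strategy in the other, and vice versa. -/
theorem interchange {A B : Assessment} {q U e V : ℝ} (he : 0 < e) (hq0 : 0 < q)
    (hq1 : q < 1) (hU0 : 0 < U) (hV : V = (1 - q) / q * ((1 - U) / U))
    (hA : A.IsPBE q U e) (hAT : A.Truthful) (hB : B.IsPBE q U e) (hBT : B.Truthful) :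
    (∀ φ, IsRule φ → gain V φ (truthLaw e) (A.quack.prod (signalLaw e)) ≤
      gain V B.select (truthLaw e) (A.quack.prod (signalLaw e))) ∧
    ∫ m, pooledProb B.select e m ∂A.quack = ∫ m, pooledProb B.select e m ∂B.quack := by
  have := A.quack_prob
  have := B.quack_prob
  have a1 : ∀ φ, IsRule φ → _ := fun φ hφ => gain_le_of_isPBE he hq0 hq1 hU0 hV hA hφ
  have b1 := gain_le_of_isPBE he hq0 hq1 hU0 hV hB A.isRule
  have a2 := quack_deviation_mixed he hA B.quack
  have b2 := quack_deviation_mixed he hB A.quack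
  rw [expertLaw_eq_of_truthful B hBT he, quackLaw_eq B he] at b1
  rw [quackLaw_eq A he] at a2
  rw [quackLaw_eq B he] at b2
  simp only [expertLaw_eq_of_truthful A hAT he, quackLaw_eq A he] at a1
  have a1' := a1 _ B.isRule
  -- Four inequalities form a cycle through the pairs (rule, quack strategy): (B,A) ≤ (A,A) ≤ (A,B)
  -- ≤ (B,B) ≤ (B,A). Hence all are equalities.
  have h : gain V A.select (truthLaw e) (A.quack.prod (signalLaw e)) =
      gain V B.select (truthLaw e) (A.quack.prod (signalLaw e)) := by
    unfold gain at *; linarith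
  refine ⟨fun φ hφ => h ▸ a1 φ hφ, ?_⟩
  rw [← integral_prod_signalLaw B.isRule he, ← integral_prod_signalLaw B.isRule he]
  unfold gain at *; linarith

/-! ### Joint densities and the upper bound on the quack's density. -/

theorem lintegral_truthLaw {e : ℝ} (he : 0 < e) {h : Pt × ℝ → ℝ≥0∞} (hh : Measurable h) :
    ∫⁻ x, h x ∂truthLaw e = ∫⁻ m : Pt, (ENNReal.ofReal (1 / (4 * e)) *
      ∫⁻ s in Icc ((m : ℝ) - e) (m + e), h (m, s)) ∂lebPt := by
  have := isProbabilityMeasure_noise he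
  rw [truthLaw, lintegral_map hh (by fun_prop), lintegral_prod _ (by fun_prop), prior_eq,
    lintegral_smul_measure, smul_eq_mul, ← lintegral_const_mul' _ _ ENNReal.ofReal_ne_top]
  refine lintegral_congr fun m => ?_
  rw [lintegral_noise he (m : ℝ) (h := fun s => h (m, s)) (by fun_prop), ← mul_assoc,
    ← ENNReal.ofReal_mul (by norm_num)]
  congr 2
  field_simp; norm_num

/-- The density of the joint law of message and signal if the expert is truthful. -/
def truthDensity (e : ℝ) (x : Pt × ℝ) : ℝ := if |x.2 - x.1| ≤ e then 1 / (4 * e) else 0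

theorem measurable_truthDensity (e : ℝ) : Measurable (truthDensity e) :=
  Measurable.ite (measurableSet_le (by fun_prop) measurable_const) measurable_const
    measurable_const

theorem truthDensity_nonneg {e : ℝ} (he : 0 < e) (x : Pt × ℝ) : 0 ≤ truthDensity e x := by
  unfold truthDensity; split_ifs <;> positivity

theorem abs_sub_le_iff_mem {s m e : ℝ} : |s - m| ≤ e ↔ s ∈ Icc (m - e) (m + e) := by
  rw [abs_le, mem_Icc]; constructor <;> rintro ⟨h1, h2⟩ <;> constructor <;> linarith

theorem truthLaw_eq {e : ℝ} (he : 0 < e) :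
    truthLaw e = (lebPt.prod volume).withDensity fun x => ENNReal.ofReal (truthDensity e x) := by
  have hm := (measurable_truthDensity e).ennreal_ofReal
  refine Measure.ext_of_lintegral _ fun h hh => ?_
  rw [lintegral_truthLaw he hh, lintegral_withDensity_eq_lintegral_mul _ hm hh,
    lintegral_prod _ (hm.mul hh).aemeasurable]
  refine lintegral_congr fun m => ?_
  rw [← lintegral_const_mul' _ _ ENNReal.ofReal_ne_top, ← lintegral_indicator measurableSet_Icc]
  refine lintegral_congr fun s => ?_
  simp only [indicator, truthDensity, Pi.mul_apply, abs_sub_le_iff_mem]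
  split_ifs <;> simp

theorem pooledProb_eq_integral {φ : Pt → ℝ → ℝ} {e : ℝ} (he : 0 < e) (m : Pt) :
    pooledProb φ e m = ∫ s, signalDensity e s * φ m s := by
  rw [pooledProb, signalLaw_eq he, integral_withDensity_eq_integral_toReal_smul
    (continuous_signalDensity e).measurable.ennreal_ofReal
    (ae_of_all _ fun x => ENNReal.ofReal_lt_top)]
  refine integral_congr_ae (ae_of_all _ fun s => ?_)
  simp only [smul_eq_mul]
  rw [ENNReal.toReal_ofReal (signalDensity_nonneg he s)]

theorem integrable_signalDensity {e : ℝ} (he : 0 < e) : Integrable (signalDensity e) := by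
  have := isProbabilityMeasure_signalLaw he
  refine ⟨(continuous_signalDensity e).aestronglyMeasurable, ?_⟩
  rw [hasFiniteIntegral_iff_ofReal (ae_of_all _ (signalDensity_nonneg he)),
    ← setLIntegral_univ, ← withDensity_apply _ .univ, ← signalLaw_eq he]
  exact measure_lt_top _ _

/-- Otherwise the judge would profit from rejecting on `C`; the competing rule is `φ` minus the
indicator of `C`. -/
theorem lintegral_indicator_le_of_gain_le {φ : Pt → ℝ → ℝ} {e V : ℝ} (he : 0 < e) (hV : 0 ≤ V)
    (hφ : IsRule φ) (Q : Measure Pt) [IsProbabilityMeasure Q]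
    (hmax : ∀ φ', IsRule φ' → gain V φ' (truthLaw e) (Q.prod (signalLaw e)) ≤
      gain V φ (truthLaw e) (Q.prod (signalLaw e)))
    {C : Set (Pt × ℝ)} (hC : MeasurableSet C) (h1 : ∀ x ∈ C, φ x.1 x.2 = 1) :
    Q.prod (signalLaw e) C ≤ ENNReal.ofReal V * truthLaw e C := by
  have := isProbabilityMeasure_signalLaw he
  have := isProbabilityMeasure_truthLaw he
  have hψ : IsRule fun m s => φ m s - C.indicator 1 (m, s) := by
    constructor
    · exact hφ.meas.sub (measurable_one.indicator hC)
    · intro m s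
      by_cases h : (m, s) ∈ C
      · simp [h, h1 _ h]
      · simpa [h] using hφ.mem m s
  have h := hmax _ hψ
  have hi : ∀ (μ : Measure (Pt × ℝ)) [IsProbabilityMeasure μ],
      ∫ x, (φ x.1 x.2 - C.indicator 1 (x.1, x.2)) ∂μ = ∫ x, φ x.1 x.2 ∂μ - μ.real C := by
    intro μ _
    rw [← integral_indicator_one hC]
    exact integral_sub (hφ.integrable μ) ((integrable_const (1 : ℝ)).indicator hC)
  rw [gain, gain, hi, hi] at h
  have h2 : (Q.prod (signalLaw e)).real C ≤ V * (truthLaw e).real C := by linarith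
  rw [← ofReal_measureReal (measure_ne_top _ _), ← ofReal_measureReal (μ := truthLaw e)
    (measure_ne_top _ _), ← ENNReal.ofReal_mul hV]
  exact ENNReal.ofReal_le_ofReal h2

/-- On the set of selected pairs at which a quack of density `F` would be too likely to be worth
selecting, the quack's law must still be dominated by `V` times the expert's. Integrating out the
signal leaves a strictly positive weight `k`, which can be cancelled. -/
theorem le_withDensity_mul_of_gain_le {φ : Pt → ℝ → ℝ} {e V : ℝ} (he : 0 < e) (hV : 0 < V)
    (hφ : IsRule φ) (Q : Measure Pt) [IsProbabilityMeasure Q]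
    (hmax : ∀ φ', IsRule φ' → gain V φ' (truthLaw e) (Q.prod (signalLaw e)) ≤
      gain V φ (truthLaw e) (Q.prod (signalLaw e)))
    {F : Pt → ℝ} (hF : Measurable F) (hF0 : ∀ m, 0 ≤ F m)
    (hpos : ∀ m : Pt, 0 < volume {s : ℝ | |s - m| ≤ e ∧ φ m s = 1 ∧
      V / (4 * e) < F m * signalDensity e s}) :
    Q ≤ lebPt.withDensity fun m => ENNReal.ofReal (F m) := by
  have := isProbabilityMeasure_signalLaw he
  set S : Set (Pt × ℝ) := {x | |x.2 - x.1| ≤ e ∧ φ x.1 x.2 = 1 ∧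
      V / (4 * e) < F x.1 * signalDensity e x.2} with hSdef
  have hd : Measurable fun x : Pt × ℝ => |x.2 - x.1| := by fun_prop
  have hS : MeasurableSet S := by
    have h2 : Measurable fun x : Pt × ℝ => F x.1 * signalDensity e x.2 :=
      (hF.comp measurable_fst).mul ((continuous_signalDensity e).measurable.comp measurable_snd)
    have h1 : MeasurableSet {x : Pt × ℝ | φ x.1 x.2 = 1} := hφ.meas (measurableSet_singleton 1)
    exact (measurableSet_le hd measurable_const).inter
      (h1.inter (measurableSet_lt measurable_const h2))
  set k : Pt → ℝ≥0∞ := fun m => signalLaw e (Prod.mk m ⁻¹' S) with hk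
  have hkm : Measurable k := measurable_measure_prodMk_left hS
  have hsl : ∀ m, MeasurableSet (Prod.mk m ⁻¹' S) := fun m => measurable_prodMk_left hS
  have hkeq : ∀ m, k m = ∫⁻ s in Prod.mk m ⁻¹' S, ENNReal.ofReal (signalDensity e s) := by
    intro m
    simp only [hk]
    rw [signalLaw_eq he, withDensity_apply _ (hsl m)]
  have hk0 : ∀ m, k m ≠ 0 := by
    intro m h
    rw [hkeq, setLIntegral_eq_zero_iff (hsl m)
      (continuous_signalDensity e).measurable.ennreal_ofReal] at h
    refine (hpos m).ne' (measure_mono_null ?_ h)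
    rintro s hs hcon
    have h3 := hcon hs
    rw [ENNReal.ofReal_eq_zero] at h3
    have : 0 < V / (4 * e) := by positivity
    nlinarith [hs.2.2, hF0 m]
  have hle : ∀ A, MeasurableSet A → ∫⁻ m in A, k m ∂Q ≤
      ∫⁻ m in A, ENNReal.ofReal (F m) * k m ∂lebPt := by
    intro A hA
    have hC : MeasurableSet (S ∩ Prod.fst ⁻¹' A) := hS.inter (measurable_fst hA)
    have h := lintegral_indicator_le_of_gain_le he hV.le hφ Q hmax hC fun x hx => hx.1.2.1
    have h1 : Q.prod (signalLaw e) (S ∩ Prod.fst ⁻¹' A) = ∫⁻ m in A, k m ∂Q := by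
      rw [Measure.prod_apply hC, ← lintegral_indicator hA]
      refine lintegral_congr fun m => ?_
      by_cases hm : m ∈ A
      · rw [indicator_of_mem hm]
        exact congrArg _ (by ext s; simp [hm])
      · rw [indicator_of_notMem hm, ← measure_empty (μ := signalLaw e)]
        exact congrArg _ (by ext s; simp [hm])
    have h2 : ENNReal.ofReal V * truthLaw e (S ∩ Prod.fst ⁻¹' A) ≤
        ∫⁻ m in A, ENNReal.ofReal (F m) * k m ∂lebPt := by
      rw [← lintegral_indicator_one hC, lintegral_truthLaw he (measurable_one.indicator hC),
        ← lintegral_const_mul' _ _ ENNReal.ofReal_ne_top, ← lintegral_indicator hA]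
      refine lintegral_mono fun m => ?_
      rw [← mul_assoc, ← ENNReal.ofReal_mul hV.le]
      by_cases hm : m ∈ A
      · rw [indicator_of_mem hm, hkeq, ← lintegral_const_mul' _ _ ENNReal.ofReal_ne_top,
          ← lintegral_const_mul' _ _ ENNReal.ofReal_ne_top, ← lintegral_indicator measurableSet_Icc,
          ← lintegral_indicator (hsl m)]
        refine lintegral_mono fun s => ?_
        by_cases hs : (m, s) ∈ S
        · have hs' : s ∈ Icc ((m : ℝ) - e) (m + e) := abs_sub_le_iff_mem.1 hs.1
          rw [indicator_of_mem hs', indicator_of_mem (show s ∈ Prod.mk m ⁻¹' S from hs),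
            indicator_of_mem (show (m, s) ∈ S ∩ Prod.fst ⁻¹' A from ⟨hs, hm⟩), Pi.one_apply,
            mul_one, ← ENNReal.ofReal_mul (hF0 m)]
          refine ENNReal.ofReal_le_ofReal ?_
          rw [mul_one_div]; exact hs.2.2.le
        · have : (m, s) ∉ S ∩ Prod.fst ⁻¹' A := fun h => hs h.1
          simp [indicator, this]
      · have : ∀ s, (m, s) ∉ S ∩ Prod.fst ⁻¹' A := fun s h => hm h.2
        simp [indicator, this]
    exact h1 ▸ h.trans h2
  set ν : Measure Pt := lebPt.withDensity fun m => ENNReal.ofReal (F m) with hν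
  have hle' : Q.withDensity k ≤ ν.withDensity k := by
    refine Measure.le_intro fun A hA _ => ?_
    rw [withDensity_apply _ hA, withDensity_apply _ hA, hν,
      setLIntegral_withDensity_eq_setLIntegral_mul _ hF.ennreal_ofReal hkm hA]
    exact hle A hA
  have hktop : ∀ m, k m ≠ ∞ := fun m => measure_ne_top _ _
  -- Since `0 < k < ∞` everywhere, the weighted inequality is divided by `k`.
  have hinv : ∀ μ : Measure Pt, (μ.withDensity k).withDensity k⁻¹ = μ := fun μ =>
    withDensity_inv_same hkm (ae_of_all _ hk0) (ae_of_all _ hktop)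
  rw [← hinv Q, ← hinv ν]
  refine Measure.le_intro fun A hA _ => ?_
  rw [withDensity_apply _ hA, withDensity_apply _ hA]
  exact lintegral_mono' (Measure.restrict_mono le_rfl hle') le_rfl

/-- A quack's strategy against which `φ` is optimal has density at most `F` if at states just below
which `φ` selects, the density `F` makes the judge nearly indifferent. -/
theorem le_withDensity_of_gain_le {φ : Pt → ℝ → ℝ} {e V : ℝ} (he : 0 < e) (hV : 0 < V)
    (hφ : IsRule φ) (Q : Measure Pt) [IsProbabilityMeasure Q]
    (hmax : ∀ φ', IsRule φ' → gain V φ' (truthLaw e) (Q.prod (signalLaw e)) ≤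
      gain V φ (truthLaw e) (Q.prod (signalLaw e)))
    {F : Pt → ℝ} (hF : Measurable F) (hF0 : ∀ m, 0 ≤ F m)
    (hpos : ∀ m : Pt, ∀ η > 0, 0 < volume {s : ℝ | |s - m| ≤ e ∧ φ m s = 1 ∧
      V / (4 * e) < (1 + η) * F m * signalDensity e s}) :
    Q ≤ lebPt.withDensity fun m => ENNReal.ofReal (F m) := by
  have h : ∀ η > 0, ∀ A, MeasurableSet A → Q A ≤ ENNReal.ofReal (1 + η) *
      lebPt.withDensity (fun m => ENNReal.ofReal (F m)) A := by
    intro η hη A hA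
    have h1 := le_withDensity_mul_of_gain_le he hV hφ Q hmax (F := fun m => (1 + η) * F m)
      (hF.const_mul _) (fun m => mul_nonneg (by linarith) (hF0 m)) (fun m => hpos m η hη) A
    rw [withDensity_apply _ hA] at h1 ⊢
    rw [← lintegral_const_mul' _ _ ENNReal.ofReal_ne_top]
    simpa only [ENNReal.ofReal_mul (by linarith : 0 ≤ 1 + η)] using h1
  refine Measure.le_intro fun A hA _ => ?_
  have ht : Filter.Tendsto (fun η : ℝ => ENNReal.ofReal (1 + η) *
      lebPt.withDensity (fun m => ENNReal.ofReal (F m)) A) (nhdsWithin 0 (Ioi 0))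
      (nhds (ENNReal.ofReal (1 + 0) * lebPt.withDensity (fun m => ENNReal.ofReal (F m)) A)) := by
    refine ENNReal.Tendsto.mul_const ?_ (Or.inl (by simp))
    have : Continuous fun η : ℝ => ENNReal.ofReal (1 + η) :=
      ENNReal.continuous_ofReal.comp (by fun_prop)
    exact this.continuousAt.tendsto.mono_left nhdsWithin_le_nhds
  have := ge_of_tendsto ht (Filter.eventually_of_mem self_mem_nhdsWithin fun η hη => h η hη A hA)
  simpa using this

/-! ### From a density and a likelihood ratio rule to a truthful equilibrium. -/

/-- Beliefs are computed from the joint densities. The quack is indifferent on his support by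
assumption; the content is that the expert has no reason to lie. -/
theorem exists_truthful_isPBE {q U e V lam : ℝ} (he : 0 < e) (hq0 : 0 < q)
    (hq1 : q < 1) (hU0 : 0 < U) (hU1 : U < 1) (hV : V = (1 - q) / q * ((1 - U) / U))
    {f : Pt → ℝ} (hf : Measurable f) (hf0 : ∀ m, 0 ≤ f m)
    (hf1 : ∫⁻ m, ENNReal.ofReal (f m) ∂lebPt = 1) {φ : Pt → ℝ → ℝ} (hφ : IsRule φ)
    (hsupp : ∀ (m : Pt) (s : ℝ), e < |s - (m : ℝ)| → φ m s = 0)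
    (hsel : ∀ (m : Pt) (s : ℝ), |s - (m : ℝ)| ≤ e → f m * signalDensity e s < V / (4 * e) → φ m s = 1)
    (hrej : ∀ (m : Pt) (s : ℝ), |s - (m : ℝ)| ≤ e → V / (4 * e) < f m * signalDensity e s → φ m s = 0)
    (hle : ∀ m, pooledProb φ e m ≤ lam) (heq : ∀ m, 0 < f m → pooledProb φ e m = lam) :
    ∃ A : Assessment, A.IsPBE q U e ∧ A.Truthful ∧
      A.quack = lebPt.withDensity (fun m => ENNReal.ofReal (f m)) ∧ A.select = φ := by
  have hV0 : 0 < V := by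
    rw [hV]; exact mul_pos (div_pos (by linarith) hq0) (div_pos (by linarith) hU0)
  have hp := isProbabilityMeasure_signalLaw he
  have hpt := isProbabilityMeasure_truthLaw he
  set Q : Measure Pt := lebPt.withDensity fun m => ENNReal.ofReal (f m) with hQ
  have hQp : IsProbabilityMeasure Q := ⟨by rw [hQ, withDensity_apply _ .univ, setLIntegral_univ, hf1]⟩
  have hgm : Measurable (signalDensity e) := (continuous_signalDensity e).measurable
  set d : Pt × ℝ → ℝ := fun x =>
    (1 - q) * truthDensity e x + q * (f x.1 * signalDensity e x.2) with hd
  have hdm : Measurable d := ((measurable_truthDensity e).const_mul _).add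
    (((hf.comp measurable_fst).mul (hgm.comp measurable_snd)).const_mul _)
  have h0 : ∀ x, 0 ≤ (1 - q) * truthDensity e x := fun x =>
    mul_nonneg (by linarith) (truthDensity_nonneg he x)
  have h0' : ∀ x : Pt × ℝ, 0 ≤ q * (f x.1 * signalDensity e x.2) := fun x =>
    mul_nonneg hq0.le (mul_nonneg (hf0 _) (signalDensity_nonneg he _))
  -- If the signal is farther than `e` from the message the numerator vanishes, so the belief is `0`
  -- there, also where the denominator is `0`. This fits the rejection required by `hsupp`.
  set b : Pt → ℝ → ℝ := fun m s => (1 - q) * truthDensity e (m, s) / d (m, s) with hb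
  have hbd : ∀ x : Pt × ℝ, d x * b x.1 x.2 = (1 - q) * truthDensity e x := by
    intro x
    rcases eq_or_ne (d x) 0 with h | h
    · rw [h, zero_mul]; linarith [h0 x, h0' x, h, show d x = _ + _ from rfl]
    · exact mul_div_cancel₀ _ h
  let A : Assessment :=
    { expert := Kernel.id
      expert_markov := inferInstance
      quack := Q
      quack_prob := hQp
      select := φ
      select_meas := hφ.meas
      select_mem := hφ.mem
      belief := b
      belief_meas := ((measurable_truthDensity e).const_mul _).div hdm
      belief_mem := fun m s => ⟨div_nonneg (h0 _) (add_nonneg (h0 _) (h0' _)),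
        div_le_one_of_le₀ (le_add_of_nonneg_right (h0' _)) (add_nonneg (h0 _) (h0' _))⟩ }
  have hfg : Measurable fun x : Pt × ℝ => ENNReal.ofReal (f x.1 * signalDensity e x.2) :=
    ((hf.comp measurable_fst).mul (hgm.comp measurable_snd)).ennreal_ofReal
  have hAb : Measurable fun x : Pt × ℝ => ENNReal.ofReal (A.belief x.1 x.2) :=
    A.belief_meas.ennreal_ofReal
  have hT : A.Truthful := fun w => Kernel.id_apply w
  have hE := expertLaw_eq_of_truthful A hT he
  have hQl : A.quackLaw e = (lebPt.prod volume).withDensity fun x =>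
      ENNReal.ofReal (f x.1 * signalDensity e x.2) := by
    rw [quackLaw_eq A he, signalLaw_eq he]
    change (lebPt.withDensity _).prod _ = _
    rw [prod_withDensity hf.ennreal_ofReal hgm.ennreal_ofReal]
    simp only [ENNReal.ofReal_mul (hf0 _)]
  have hobs : A.observedLaw q e = (lebPt.prod volume).withDensity fun x => ENNReal.ofReal (d x) := by
    rw [Assessment.observedLaw, hE, truthLaw_eq he, hQl,
      ← withDensity_smul _ (measurable_truthDensity e).ennreal_ofReal,
      ← withDensity_smul _ hfg,
      ← withDensity_add_left ((measurable_truthDensity e).ennreal_ofReal.const_smul _)]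
    congr 1
    ext x
    simp only [hd, Pi.add_apply, Pi.smul_apply, smul_eq_mul]
    rw [ENNReal.ofReal_add (h0 x) (h0' x), ENNReal.ofReal_mul (p := 1 - q) (by linarith),
      ENNReal.ofReal_mul (p := q) hq0.le]
  have hbayes : ∀ B : Set (Pt × ℝ), MeasurableSet B →
      ∫ x in B, A.belief x.1 x.2 ∂(A.observedLaw q e) = (1 - q) * (A.expertLaw e).real B := by
    intro B hB
    rw [integral_eq_lintegral_of_nonneg_ae (ae_of_all _ fun x => (A.belief_mem _ _).1)
      A.belief_meas.aestronglyMeasurable, hobs,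
      setLIntegral_withDensity_eq_setLIntegral_mul _ hdm.ennreal_ofReal
      hAb hB, hE, truthLaw_eq he, Measure.real, withDensity_apply _ hB,
      ← ENNReal.toReal_ofReal (by linarith : 0 ≤ 1 - q), ← ENNReal.toReal_mul,
      ← lintegral_const_mul' _ _ ENNReal.ofReal_ne_top]
    congr 1
    refine lintegral_congr fun x => ?_
    rw [Pi.mul_apply, ← ENNReal.ofReal_mul (by linarith : 0 ≤ 1 - q), ← hbd,
      ENNReal.ofReal_mul (add_nonneg (h0 _) (h0' _))]
  have hpool : ∀ m, ∫ w : Pt, A.selectProb e w m ∂prior = pooledProb φ e m := fun m =>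
    (pooledProb_eq hφ he m).symm
  have hqopt : ∀ m : Pt, ∫ w, A.selectProb e w m ∂prior ≤
      ∫ m', (∫ w, A.selectProb e w m' ∂prior) ∂A.quack := by
    intro m
    simp only [hpool]
    have hae : ∀ᵐ m' ∂Q, pooledProb φ e m' = lam := by
      rw [hQ, ae_withDensity_iff hf.ennreal_ofReal]
      refine ae_of_all _ fun m' hm' => heq m' ?_
      rwa [Ne, ENNReal.ofReal_eq_zero, not_le] at hm'
    change _ ≤ ∫ m', pooledProb φ e m' ∂Q
    rw [integral_congr_ae hae]
    simpa using hle m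
  have hsp : ∀ w m : Pt, A.selectProb e w m =
      1 / (2 * e) * ∫ s in Icc ((w : ℝ) - e) (w + e), φ m s := fun w m =>
    integral_noise he (w : ℝ) (h := φ m) (hφ.meas.comp measurable_prodMk_left)
  have hnp : ∀ w m : Pt, ∫ s in Icc ((w : ℝ) - e) (w + e), φ m s ≤
      ∫ s in Icc ((w : ℝ) - e) (w + e), φ w s := by
    intro w m
    have hi : ∀ m, IntegrableOn (φ m) (Icc ((w : ℝ) - e) (w + e)) := fun m =>
      hφ.integrable_comp _ measurable_const measurable_id
    have hgi : ∀ m, Integrable fun s => signalDensity e s * φ m s := fun m =>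
      (integrable_signalDensity he).mul_bdd (c := 1)
        (hφ.meas.comp measurable_prodMk_left).aestronglyMeasurable (ae_of_all _ fun s => by
          change |φ m s| ≤ 1
          rw [abs_of_nonneg (hφ.mem m s).1]; exact (hφ.mem m s).2)
    rcases (hf0 w).eq_or_lt with h | h
    -- A state which the quack never reports: every compatible signal is selected, so no lie can do
    -- better.
    · refine setIntegral_mono_on (hi m) (hi w) measurableSet_Icc fun s hs => ?_
      rw [hsel w s (abs_sub_le_iff_mem.2 hs) (by rw [← h, zero_mul]; positivity)]
      exact (hφ.mem m s).2
    · set c := V / (4 * e) with hc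
      have hc0 : 0 < c := by positivity
      have h1 : ∫ s in Icc ((w : ℝ) - e) (w + e), signalDensity e s * φ w s = lam := by
        rw [← heq w h, pooledProb_eq_integral he]
        refine setIntegral_eq_integral_of_forall_compl_eq_zero fun s hs => ?_
        rw [hsupp w s (not_le.1 fun h => hs (abs_sub_le_iff_mem.1 h)), mul_zero]
      have h2 : ∫ s in Icc ((w : ℝ) - e) (w + e), signalDensity e s * φ m s ≤ lam := by
        refine le_trans ?_ (hle m)
        rw [pooledProb_eq_integral he]
        exact setIntegral_le_integral (hgi m)
          (ae_of_all _ fun s => mul_nonneg (signalDensity_nonneg he s) (hφ.mem m s).1)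
      -- Neyman-Pearson: `φ w` maximizes `(c - f w * g) * φ` pointwise among values in `[0, 1]`. The
      -- term with `g` is the quack's probability, which no `m` raises above its value `lam` at `w`,
      -- so the plain integral is also largest at `w`.
      have h3 : ∫ s in Icc ((w : ℝ) - e) (w + e),
            (c * φ m s - f w * (signalDensity e s * φ m s)) ≤
          ∫ s in Icc ((w : ℝ) - e) (w + e),
            (c * φ w s - f w * (signalDensity e s * φ w s)) := by
        refine setIntegral_mono_on (((hi m).const_mul _).sub ((hgi m).integrableOn.const_mul _))
          (((hi w).const_mul _).sub ((hgi w).integrableOn.const_mul _)) measurableSet_Icc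
          fun s hs => ?_
        have hs' := abs_sub_le_iff_mem.2 hs
        have hm := hφ.mem m s
        rcases lt_trichotomy (f w * signalDensity e s) c with h4 | h4 | h4
        · rw [hsel w s hs' h4]
          nlinarith [hm.2]
        · simp only [← mul_assoc, h4, sub_self, le_refl]
        · rw [hrej w s hs' h4]
          nlinarith [hm.1]
      rw [integral_sub ((hi m).const_mul _) ((hgi m).integrableOn.const_mul _),
        integral_sub ((hi w).const_mul _) ((hgi w).integrableOn.const_mul _),
        integral_const_mul, integral_const_mul, integral_const_mul, integral_const_mul, h1] at h3
      have h5 := mul_le_mul_of_nonneg_left h2 h.le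
      exact le_of_mul_le_mul_left (by linarith) hc0
  have hbU : ∀ (m : Pt) (s : ℝ), |s - (m : ℝ)| ≤ e → b m s * (1 / (4 * e) * (1 - q) + q * (f m * signalDensity e s)) =
      (1 - q) * (1 / (4 * e)) := by
    intro m s h
    have := hbd (m, s)
    simp only [hd, truthDensity, h, if_true] at this
    linarith
  -- This translates the comparison of the belief with `U` into that of `f m * g s` with `V / (4 *
  -- e)`.
  have hVq : q * U * V = (1 - q) * (1 - U) := by rw [hV]; field_simp
  have hce : V / (4 * e) = V * (1 / (4 * e)) := by ring
  have h4e : 0 < 1 / (4 * e) := by positivity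
  refine ⟨A, ⟨fun w m => ?_, hqopt, hbayes, fun m s h => ?_, fun m s h => ?_⟩, hT, rfl, rfl⟩
  · rw [hT w, integral_dirac, hsp, hsp]
    exact mul_le_mul_of_nonneg_left (hnp w m) (by positivity)
  · change U < b m s at h
    have hs : |s - (m : ℝ)| ≤ e := by
      by_contra hs
      simp only [hb, truthDensity, hs, if_false, mul_zero, zero_div] at h
      linarith
    refine hsel m s hs ?_
    have h1 := hbU m s hs
    have h2 := h0' (m, s)
    simp only at h2
    have h3 : 0 < 1 / (4 * e) * (1 - q) := mul_pos h4e (by linarith)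
    have h4 : U * (1 / (4 * e) * (1 - q) + q * (f m * signalDensity e s)) <
        (1 - q) * (1 / (4 * e)) := by
      rw [← h1]; exact mul_lt_mul_of_pos_right h (by linarith)
    rw [hce]
    have : q * U * (f m * signalDensity e s) < q * U * (V * (1 / (4 * e))) := by
      rw [← mul_assoc (q * U) V, hVq]; linarith
    exact lt_of_mul_lt_mul_left this (by positivity)
  · change b m s < U at h
    by_cases hs : |s - (m : ℝ)| ≤ e
    · refine hrej m s hs ?_
      have h1 := hbU m s hs
      have h2 := h0' (m, s)
      simp only at h2
      have h3 : 0 < 1 / (4 * e) * (1 - q) := mul_pos h4e (by linarith)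
      have h4 : (1 - q) * (1 / (4 * e)) <
          U * (1 / (4 * e) * (1 - q) + q * (f m * signalDensity e s)) := by
        rw [← h1]; exact mul_lt_mul_of_pos_right h (by linarith)
      rw [hce]
      have : q * U * (V * (1 / (4 * e))) < q * U * (f m * signalDensity e s) := by
        rw [← mul_assoc (q * U) V, hVq]; linarith
      exact lt_of_mul_lt_mul_left this (by positivity)
    · exact hsupp m s (not_le.1 hs)

/-! ### Tail probabilities of the signal and the cutoff rule. -/

/-- The probability that the signal exceeds `x`, for `-(1 - e) ≤ x ≤ 1 + e`. -/
def upperTail (e x : ℝ) : ℝ := (1 - x) / 2 + max (x - (1 - e)) 0 ^ 2 / (8 * e)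

theorem continuous_upperTail (e : ℝ) : Continuous (upperTail e) := by
  unfold upperTail; fun_prop

theorem upperTail_of_le {e x : ℝ} (h : x ≤ 1 - e) : upperTail e x = (1 - x) / 2 := by
  rw [upperTail, max_eq_right (by linarith)]; ring

theorem upperTail_of_ge {e x : ℝ} (he : 0 < e) (h : 1 - e ≤ x) :
    upperTail e x = (1 + e - x) ^ 2 / (8 * e) := by
  rw [upperTail, max_eq_left (by linarith)]; field_simp; ring

theorem upperTail_lt {e a b : ℝ} (he : 0 < e) (hab : a < b) (hb : b ≤ 1 + e) :
    upperTail e b < upperTail e a := by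
  rcases le_total b (1 - e) with h | h
  · rw [upperTail_of_le h, upperTail_of_le (by linarith)]; linarith
  · rw [upperTail_of_ge he h]
    rcases le_total a (1 - e) with h' | h'
    · rw [upperTail_of_le h', div_lt_iff₀ (by positivity)]
      nlinarith
    · rw [upperTail_of_ge he h']
      refine div_lt_div_of_pos_right ?_ (by positivity)
      nlinarith

theorem upperTail_le {e a b : ℝ} (he : 0 < e) (hab : a ≤ b) (hb : b ≤ 1 + e) :
    upperTail e b ≤ upperTail e a := by
  rcases hab.eq_or_lt with h | h
  · rw [h]
  · exact (upperTail_lt he h hb).le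

theorem upperTail_nonneg {e a : ℝ} (he : 0 < e) (ha : a ≤ 1 + e) : 0 ≤ upperTail e a := by
  have h := upperTail_le he ha le_rfl
  rw [upperTail_of_ge he (by linarith : 1 - e ≤ 1 + e)] at h
  simpa using h

theorem setIntegral_signalDensity {e a b : ℝ} (he : 0 < e) (hab : a ≤ b)
    (ha : -(1 - e) ≤ a) (hb : b ≤ 1 + e) :
    ∫ s in Icc a b, signalDensity e s = upperTail e a - upperTail e b := by
  rw [integral_Icc_eq_integral_Ioc, ← intervalIntegral.integral_of_le hab]
  -- The two formulas for the tail meet at `1 - e`, which is removed as an exceptional point.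
  have h := integral_eq_of_hasDerivAt_off_countable_of_le (fun x => -upperTail e x)
    (signalDensity e) hab (countable_singleton (1 - e)) (continuous_upperTail e).neg.continuousOn
    (fun x hx => ?_) (continuous_signalDensity e).continuousOn.intervalIntegrable
  · rw [h]; ring
  · obtain ⟨⟨h1, h2⟩, h3⟩ := hx
    rw [signalDensity_eq he (by linarith) (by linarith)]
    have hlin : HasDerivAt (fun x : ℝ => (1 - x) / 2) (-1 / 2) x :=
      ((hasDerivAt_id x).const_sub 1).div_const 2
    rcases lt_or_gt_of_ne h3 with h4 | h4
    · rw [max_eq_right (by linarith)]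
      have := hlin.neg.congr_of_eventuallyEq (f₁ := fun x => -upperTail e x)
        (Filter.eventually_of_mem (Iio_mem_nhds h4) fun y hy => by
          simp only [Pi.neg_apply]; rw [upperTail_of_le (le_of_lt hy)])
      convert this using 1; ring
    · rw [max_eq_left (by linarith)]
      have hq : HasDerivAt (fun x : ℝ => (1 + e - x) ^ 2 / (8 * e))
          (((2 : ℕ) * (1 + e - x) ^ (2 - 1) * -1) / (8 * e)) x :=
        (((hasDerivAt_id x).const_sub (1 + e)).pow 2).div_const (8 * e)
      have := hq.neg.congr_of_eventuallyEq (f₁ := fun x => -upperTail e x)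
        (Filter.eventually_of_mem (Ioi_mem_nhds h4) fun y hy => by
          simp only [Pi.neg_apply]; rw [upperTail_of_ge he (le_of_lt hy)])
      convert this using 1
      field_simp
      push_cast
      ring

/-- The probability that the signal is within `e` of `x`. -/
def nearProb (e x : ℝ) : ℝ := upperTail e (x - e) - upperTail e (x + e)

/-- All signals near `x` have density `1/2` until the window `[x - e, x + e]` reaches beyond `1 -
e`. Hence the probability is constant up to `1 - 2 * e` and strictly decreasing from there to `1`,
which decides where the quack's support is pinned down. -/
theorem nearProb_eq {e x : ℝ} (hx : x ≤ 1) :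
    nearProb e x = e - max (x + 2 * e - 1) 0 ^ 2 / (8 * e) := by
  rw [nearProb, upperTail_of_le (by linarith : x - e ≤ 1 - e), upperTail]
  have : x + e - (1 - e) = x + 2 * e - 1 := by ring
  rw [this]; ring

theorem nearProb_le {e x : ℝ} (he : 0 < e) (hx : x ≤ 1) : nearProb e x ≤ e := by
  rw [nearProb_eq hx]
  have : 0 ≤ max (x + 2 * e - 1) 0 ^ 2 / (8 * e) := by positivity
  linarith

theorem nearProb_eq_self {e x : ℝ} (he : 0 < e) (hx : x ≤ 1 - 2 * e) :
    nearProb e x = e := by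
  rw [nearProb_eq (by linarith), max_eq_right (by linarith)]; simp

theorem nearProb_lt {e x y : ℝ} (he : 0 < e) (hxy : x < y) (hy : 1 - 2 * e < y) (hy1 : y ≤ 1) :
    nearProb e y < nearProb e x := by
  rw [nearProb_eq hy1, nearProb_eq (hxy.le.trans hy1)]
  have h : max (x + 2 * e - 1) 0 < max (y + 2 * e - 1) 0 := by
    rw [max_eq_left (by linarith : 0 ≤ y + 2 * e - 1)]
    exact max_lt (by linarith) (by linarith)
  have h2 : max (x + 2 * e - 1) 0 ^ 2 < max (y + 2 * e - 1) 0 ^ 2 :=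
    pow_lt_pow_left₀ h (le_max_right _ _) (by norm_num)
  have := div_lt_div_of_pos_right h2 (by positivity : 0 < 8 * e)
  linarith

theorem nearProb_anti {e x y : ℝ} (he : 0 < e) (hxy : x ≤ y) (hy1 : y ≤ 1) :
    nearProb e y ≤ nearProb e x := by
  rw [nearProb_eq hy1, nearProb_eq (hxy.trans hy1)]
  have : max (x + 2 * e - 1) 0 ^ 2 / (8 * e) ≤ max (y + 2 * e - 1) 0 ^ 2 / (8 * e) := by
    gcongr
  linarith

theorem half_le_nearProb {e x : ℝ} (he : 0 < e) (hx : x ≤ 1) : e / 2 ≤ nearProb e x := by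
  refine le_trans (le_of_eq ?_) (nearProb_anti he hx le_rfl)
  rw [nearProb_eq le_rfl, max_eq_left (by linarith)]
  field_simp; ring

/-- After a message `x ≥ 0`, the judge selects the speaker if the signal lies in the upper part, of
probability `lam`, of the interval `[x - e, x + e]`. -/
def cutoff (e lam x s : ℝ) : ℝ :=
  open Classical in if |s - x| ≤ e ∧ upperTail e s ≤ upperTail e (x + e) + lam then 1 else 0

theorem integral_cutoff {e lam x : ℝ} (he : 0 < e) (he' : e ≤ 1 / 2) (hx0 : 0 ≤ x) (hx1 : x ≤ 1)
    (hl : 0 ≤ lam) :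
    ∫ s, signalDensity e s * cutoff e lam x s = min lam (nearProb e x) := by
  have key : ∀ t, x - e ≤ t → t ≤ x + e →
      (∀ s ∈ Icc (x - e) (x + e), upperTail e s ≤ upperTail e (x + e) + lam ↔ t ≤ s) →
      ∫ s, signalDensity e s * cutoff e lam x s = upperTail e t - upperTail e (x + e) := by
    intro t h1 h2 h3
    rw [← setIntegral_signalDensity he h2 (by linarith) (by linarith),
      ← integral_indicator measurableSet_Icc]
    refine integral_congr_ae (ae_of_all _ fun s => ?_)
    simp only [indicator, cutoff, abs_sub_le_iff_mem]
    by_cases hs : s ∈ Icc (x - e) (x + e)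
    · by_cases hts : t ≤ s
      · simp [hs, (h3 s hs).2 hts, show s ∈ Icc t (x + e) from ⟨hts, hs.2⟩]
      · simp [hs, mt (h3 s hs).1 hts, show s ∉ Icc t (x + e) from fun h => hts h.1]
    · simp [hs, show s ∉ Icc t (x + e) from fun h => hs ⟨h1.trans h.1, h.2⟩]
  rcases le_total (nearProb e x) lam with h | h
  · rw [min_eq_right h, nearProb]
    rw [nearProb] at h
    refine key _ le_rfl (by linarith) fun s hs => ⟨fun _ => hs.1, fun _ => ?_⟩
    have := upperTail_le he hs.1 (by linarith [hs.2])
    linarith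
  · rw [min_eq_left h]
    -- The cutoff signal `t`: strict monotonicity of the tail turns the condition on tails into `t ≤
    -- s`.
    obtain ⟨t, ht, hte⟩ := intermediate_value_Icc' (by linarith : x - e ≤ x + e)
      (continuous_upperTail e).continuousOn
      (show upperTail e (x + e) + lam ∈ Icc (upperTail e (x + e)) (upperTail e (x - e)) from
        ⟨by linarith, by rw [nearProb] at h; linarith⟩)
    rw [key t ht.1 ht.2 fun s hs => ?_, hte]
    · ring
    · rw [← hte]
      constructor
      · intro h1
        by_contra h2
        exact absurd (upperTail_lt he (not_le.1 h2) (by linarith [ht.2])) (not_lt.2 h1)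
      · exact fun h1 => upperTail_le he h1 (by linarith [hs.2])

/-! ### Symmetric cutoff equilibria. -/

/-- The judge's rule that treats `(m, s)` and `(-m, -s)` symmetrically and follows `cutoff` for
`m ≥ 0`. -/
def cutoffRule (e lam : ℝ) (m : Pt) (s : ℝ) : ℝ :=
  cutoff e lam |(m : ℝ)| (if 0 ≤ (m : ℝ) then s else -s)

theorem isRule_cutoffRule (e lam : ℝ) : IsRule (cutoffRule e lam) := by
  constructor
  · have h1 : Measurable fun x : Pt × ℝ => |(x.1 : ℝ)| := by fun_prop
    have h2 : Measurable fun x : Pt × ℝ => if 0 ≤ (x.1 : ℝ) then x.2 else -x.2 :=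
      Measurable.ite (measurableSet_le measurable_const (by fun_prop)) measurable_snd
        measurable_snd.neg
    have h3 : Measurable fun x : Pt × ℝ => abs ((if 0 ≤ (x.1 : ℝ) then x.2 else -x.2) - |(x.1 : ℝ)|) :=
      (h2.sub h1).abs
    have h4 := (continuous_upperTail e).measurable
    refine Measurable.ite ((measurableSet_le h3 measurable_const).inter
      (measurableSet_le (h4.comp h2) ((h4.comp (h1.add_const e)).add_const lam))) measurable_const
      measurable_const
  · intro m s
    unfold cutoffRule cutoff
    split_ifs <;> simp

theorem abs_pt_le_one (m : Pt) : |(m : ℝ)| ≤ 1 := abs_le.2 m.2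

theorem pooledProb_cutoffRule {e lam : ℝ} (he : 0 < e) (he' : e ≤ 1 / 2) (hl : 0 ≤ lam) (m : Pt) :
    pooledProb (cutoffRule e lam) e m = min lam (nearProb e |(m : ℝ)|) := by
  rw [pooledProb_eq_integral he, ← integral_cutoff he he' (abs_nonneg _) (abs_pt_le_one m) hl]
  by_cases hm : 0 ≤ (m : ℝ)
  · simp only [cutoffRule, hm, if_true]
  · simp only [cutoffRule, hm, if_false]
    rw [← integral_neg_eq_self]
    simp only [neg_neg, signalDensity_neg]

theorem abs_reflect_sub (m : Pt) (s : ℝ) :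
    abs ((if 0 ≤ (m : ℝ) then s else -s) - |(m : ℝ)|) = |s - m| := by
  split_ifs with h
  · rw [abs_of_nonneg h]
  · rw [abs_of_neg (not_le.1 h), ← abs_neg]; congr 1; ring

theorem signalDensity_reflect (e : ℝ) (m : Pt) (s : ℝ) :
    signalDensity e (if 0 ≤ (m : ℝ) then s else -s) = signalDensity e s := by
  split_ifs
  · rfl
  · exact signalDensity_neg e s

theorem exists_cutoff_equilibrium {q U e V lam : ℝ} (he : 0 < e) (he' : e ≤ 1 / 2) (hq0 : 0 < q)
    (hq1 : q < 1) (hU0 : 0 < U) (hU1 : U < 1) (hV : V = (1 - q) / q * ((1 - U) / U))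
    (hl : 0 ≤ lam) {f : ℝ → ℝ} (hf : Measurable f) (hf0 : ∀ x, 0 ≤ f x)
    (hf1 : ∫⁻ x in Icc (-1 : ℝ) 1, ENNReal.ofReal (f |x|) = 1)
    (hsel : ∀ x s, 0 ≤ x → x ≤ 1 → s ∈ Icc (x - e) (x + e) →
      f x * signalDensity e s < V / (4 * e) → upperTail e s ≤ upperTail e (x + e) + lam)
    (hrej : ∀ x s, 0 ≤ x → x ≤ 1 → s ∈ Icc (x - e) (x + e) →
      V / (4 * e) < f x * signalDensity e s → upperTail e (x + e) + lam < upperTail e s)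
    (hpos : ∀ x, 0 ≤ x → x ≤ 1 → 0 < f x → lam ≤ nearProb e x) :
    ∃ A : Assessment, A.IsPBE q U e ∧ A.Truthful ∧
      A.quack = lebPt.withDensity (fun m => ENNReal.ofReal (f |(m : ℝ)|)) ∧
      A.select = cutoffRule e lam := by
  refine exists_truthful_isPBE (lam := lam) he hq0 hq1 hU0 hU1 hV
    (hf.comp (by fun_prop : Measurable fun m : Pt => |(m : ℝ)|)) (fun m => hf0 _) ?_
    (isRule_cutoffRule e lam) ?_ ?_ ?_ ?_ ?_
  · rw [← hf1]; exact lintegral_lebPt fun x => ENNReal.ofReal (f |x|)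
  · intro m s h
    rw [← abs_reflect_sub] at h
    simp [cutoffRule, cutoff, not_le.2 h]
  · intro m s h h2
    rw [← abs_reflect_sub] at h
    have := hsel _ _ (abs_nonneg _) (abs_pt_le_one m) (abs_sub_le_iff_mem.1 h)
      (by rw [signalDensity_reflect]; exact h2)
    simp [cutoffRule, cutoff, h, this]
  · intro m s h h2
    rw [← abs_reflect_sub] at h
    have := hrej _ _ (abs_nonneg _) (abs_pt_le_one m) (abs_sub_le_iff_mem.1 h)
      (by rw [signalDensity_reflect]; exact h2)
    simp [cutoffRule, cutoff, h, not_le.2 this]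
  · intro m
    rw [pooledProb_cutoffRule he he' hl]; exact min_le_left _ _
  · intro m hm
    rw [pooledProb_cutoffRule he he' hl]
    exact min_eq_left (hpos _ (abs_nonneg _) (abs_pt_le_one m) hm)

/-- Signals slightly above `s₀` remain selected because the tail decreases, and by continuity of the
signal density the factor `1 + η` keeps the inequality strict. This turns one indifferent signal
into a set of positive measure. -/
theorem exists_Ioo_cutoff {e lam V F x s₀ η : ℝ} (he : 0 < e) (hV : 0 < V) (hη : 0 < η)
    (hx1 : x ≤ 1) (h1 : x - e ≤ s₀) (h2 : s₀ < x + e)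
    (h3 : upperTail e s₀ ≤ upperTail e (x + e) + lam) (h4 : V / (4 * e) ≤ F * signalDensity e s₀) :
    ∃ a b, a < b ∧ ∀ s ∈ Ioo a b, |s - x| ≤ e ∧ cutoff e lam x s = 1 ∧
      V / (4 * e) < (1 + η) * F * signalDensity e s := by
  have h5 : V / (4 * e) < (1 + η) * F * signalDensity e s₀ := by
    have : 0 < V / (4 * e) := by positivity
    nlinarith
  have hc : Continuous fun s => (1 + η) * F * signalDensity e s :=
    continuous_const.mul (continuous_signalDensity e)
  obtain ⟨δ, hδ, hδ'⟩ := Metric.eventually_nhds_iff.1 (hc.continuousAt.eventually_const_lt h5)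
  refine ⟨s₀, min (s₀ + δ) (x + e), lt_min (by linarith) h2, fun s hs => ?_⟩
  have hs1 := lt_min_iff.1 hs.2
  have hs2 : |s - x| ≤ e := abs_sub_le_iff_mem.2 ⟨by linarith [hs.1], hs1.2.le⟩
  refine ⟨hs2, ?_, hδ' ?_⟩
  · have := upperTail_le he hs.1.le (by linarith)
    simp [cutoff, hs2, this.trans h3]
  · rw [Real.dist_eq, abs_of_pos (by linarith [hs.1])]; linarith

/-- In every truthful equilibrium, the quack's strategy has a density that is bounded by the one
which makes the judge indifferent at the cutoff of a cutoff equilibrium, and it puts all mass on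
messages that are optimal for the quack in the latter. -/
theorem quack_of_cutoff_equilibrium {A B : Assessment} {q U e V lam : ℝ} (he : 0 < e)
    (he' : e ≤ 1 / 2) (hq0 : 0 < q) (hq1 : q < 1) (hU0 : 0 < U) (hV0 : 0 < V)
    (hV : V = (1 - q) / q * ((1 - U) / U))
    (hA : A.IsPBE q U e) (hAT : A.Truthful) (hB : B.IsPBE q U e) (hBT : B.Truthful)
    (hl : 0 ≤ lam) (hsel : B.select = cutoffRule e lam) {f F : ℝ → ℝ} (hf : Measurable f)
    (hBq : B.quack = lebPt.withDensity (fun m => ENNReal.ofReal (f |(m : ℝ)|)))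
    (hpos : ∀ x, 0 ≤ x → x ≤ 1 → 0 < f x → lam ≤ nearProb e x)
    (hF : Measurable F) (hF0 : ∀ x, 0 ≤ F x)
    (hs : ∀ x, 0 ≤ x → x ≤ 1 → ∃ s₀, x - e ≤ s₀ ∧ s₀ < x + e ∧
      upperTail e s₀ ≤ upperTail e (x + e) + lam ∧ V / (4 * e) ≤ F x * signalDensity e s₀) :
    A.quack ≤ lebPt.withDensity (fun m => ENNReal.ofReal (F |(m : ℝ)|)) ∧
      ∀ᵐ m : Pt ∂A.quack, lam ≤ nearProb e |(m : ℝ)| := by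
  have := A.quack_prob
  have := B.quack_prob
  have habs : Measurable fun m : Pt => |(m : ℝ)| := by fun_prop
  obtain ⟨h1, h2⟩ := interchange he hq0 hq1 hU0 hV hA hAT hB hBT
  rw [hsel] at h1 h2
  constructor
  · refine le_withDensity_of_gain_le he hV0 (isRule_cutoffRule e lam) A.quack h1 (hF.comp habs)
      (fun m => hF0 _) fun m η hη => ?_
    obtain ⟨s₀, k1, k2, k3, k4⟩ := hs |(m : ℝ)| (abs_nonneg _) (abs_pt_le_one m)
    obtain ⟨a, b, hab, h⟩ := exists_Ioo_cutoff he hV0 hη (abs_pt_le_one m) k1 k2 k3 k4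
    have h' : ∀ s, (if 0 ≤ (m : ℝ) then s else -s) ∈ Ioo a b → |s - m| ≤ e ∧
        cutoffRule e lam m s = 1 ∧ V / (4 * e) < (1 + η) * F |(m : ℝ)| * signalDensity e s := by
      intro s hs
      have := h _ hs
      rwa [abs_reflect_sub, signalDensity_reflect] at this
    by_cases hm : 0 ≤ (m : ℝ)
    · refine lt_of_lt_of_le ?_ (measure_mono (μ := volume) (s := Ioo a b) fun s hs => h' s (by rwa [if_pos hm]))
      simp [hab]
    · refine lt_of_lt_of_le ?_ (measure_mono (μ := volume) (s := Ioo (-b) (-a)) fun s hs => h' s ?_)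
      · simp [hab]
      · rw [if_neg hm]; exact ⟨by linarith [hs.2], by linarith [hs.1]⟩
  · have hr := isRule_cutoffRule e lam
    have hfm : Measurable fun m : Pt => ENNReal.ofReal (f |(m : ℝ)|) :=
      (hf.comp habs).ennreal_ofReal
    have hae : ∀ᵐ m ∂B.quack, pooledProb (cutoffRule e lam) e m = lam := by
      rw [hBq, ae_withDensity_iff hfm]
      refine ae_of_all _ fun m hm => ?_
      rw [Ne, ENNReal.ofReal_eq_zero, not_le] at hm
      rw [pooledProb_cutoffRule he he' hl]
      exact min_eq_left (hpos _ (abs_nonneg _) (abs_pt_le_one m) hm)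
    rw [integral_congr_ae hae] at h2
    -- No message yields more than `lam` under this rule, and the average over `A.quack` equals
    -- `lam`; so almost every message yields exactly `lam`.
    have h3 : ∫ m, (lam - pooledProb (cutoffRule e lam) e m) ∂A.quack = 0 := by
      rw [integral_sub (integrable_const _) (integrable_pooledProb hr he _), h2]; simp
    rw [integral_eq_zero_iff_of_nonneg (f := fun m => lam - pooledProb (cutoffRule e lam) e m)
      (fun m => ?_) ((integrable_const _).sub (integrable_pooledProb hr he _))] at h3
    · filter_upwards [h3] with m hm
      simp only [Pi.zero_apply, pooledProb_cutoffRule he he' hl] at hm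
      have := min_le_right lam (nearProb e |(m : ℝ)|)
      linarith
    · simp only [Pi.zero_apply, pooledProb_cutoffRule he he' hl, sub_nonneg]
      exact min_le_left _ _

/-! ### Lemon-dropping: uniform quack strategies. -/

theorem map_val_withDensity {f : ℝ → ℝ≥0∞} (hf : Measurable f) :
    (lebPt.withDensity fun m => f m).map Subtype.val =
      (volume.restrict (Icc (-1 : ℝ) 1)).withDensity f := by
  refine Measure.ext_of_lintegral _ fun h hh => ?_
  have hf' : Measurable fun m : Pt => f m := hf.comp measurable_subtype_coe
  have hh' : Measurable fun m : Pt => h m := hh.comp measurable_subtype_coe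
  rw [lintegral_map hh measurable_subtype_coe, lintegral_withDensity_eq_lintegral_mul _ hf' hh',
    lintegral_withDensity_eq_lintegral_mul _ hf hh]
  exact lintegral_lebPt fun x => f x * h x

/-- The density at `x` and at `-x` of the uniform distribution on `[-b, b]`. -/
def boxDensity (b x : ℝ) : ℝ := if x ≤ b then 1 / (2 * b) else 0

theorem measurable_boxDensity (b : ℝ) : Measurable (boxDensity b) :=
  Measurable.ite measurableSet_Iic measurable_const measurable_const

theorem boxDensity_nonneg {b : ℝ} (hb : 0 < b) (x : ℝ) : 0 ≤ boxDensity b x := by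
  unfold boxDensity; split_ifs <;> positivity

theorem uniform_eq_withDensity {b : ℝ} (hb : 0 < b) (hb1 : b ≤ 1) :
    uniform (-b) b = (volume.restrict (Icc (-1 : ℝ) 1)).withDensity
      fun x => ENNReal.ofReal (boxDensity b |x|) := by
  have h : (fun x : ℝ => ENNReal.ofReal (boxDensity b |x|)) =
      (Icc (-b) b).indicator fun _ => ENNReal.ofReal (1 / (2 * b)) := by
    ext x
    simp only [boxDensity, indicator, abs_le, mem_Icc]
    split_ifs <;> simp
  rw [h, withDensity_indicator measurableSet_Icc, Measure.restrict_restrict measurableSet_Icc,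
    inter_eq_self_of_subset_left (Icc_subset_Icc (by linarith) hb1), withDensity_const,
    uniform_eq (by linarith), sub_neg_eq_add, two_mul]

theorem lintegral_boxDensity {b : ℝ} (hb : 0 < b) (hb1 : b ≤ 1) :
    ∫⁻ x in Icc (-1 : ℝ) 1, ENNReal.ofReal (boxDensity b |x|) = 1 := by
  have := isProbabilityMeasure_uniform (show -b < b by linarith)
  have h := measure_univ (μ := uniform (-b) b)
  rwa [uniform_eq_withDensity hb hb1, withDensity_apply _ .univ, setLIntegral_univ] at h

theorem quackDist_eq_uniform {A : Assessment} {b : ℝ} (hb : 0 < b) (hb1 : b ≤ 1)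
    (h : A.quack = lebPt.withDensity fun m => ENNReal.ofReal (boxDensity b |(m : ℝ)|)) :
    A.quackDist = uniform (-b) b := by
  rw [Assessment.quackDist, h, uniform_eq_withDensity hb hb1]
  exact map_val_withDensity
    (f := fun x => ENNReal.ofReal (boxDensity b |x|))
    ((measurable_boxDensity b).comp measurable_id.abs).ennreal_ofReal

theorem lt_of_signalDensity_lt {e s : ℝ} (he : 0 < e) (h1 : -(1 - e) ≤ s) (h2 : s ≤ 1 + e)
    (h : signalDensity e s < 1 / 2) : 1 - e < s := by
  by_contra hs
  rw [signalDensity_eq he h1 h2, max_eq_right (by linarith)] at h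
  simp at h

theorem signalDensity_eq_half {e s : ℝ} (he : 0 < e) (h1 : -(1 - e) ≤ s) (h2 : s ≤ 1 - e) :
    signalDensity e s = 1 / 2 := by
  rw [signalDensity_eq he h1 (by linarith), max_eq_right (by linarith)]; simp

/-- The signal density is at most `1/2`, so a quack density of at most `V / (2 * e)` never makes
rejection strictly better. At that maximal density the judge is indifferent on `s ≤ 1 - e` and must
select only above `1 - e`; those signals have probability at most `e / 2 ≤ lam`, so the rule does
select them. -/
theorem exists_box_equilibrium {q U e V lam b : ℝ} (he : 0 < e) (he' : e ≤ 1 / 2) (hq0 : 0 < q)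
    (hq1 : q < 1) (hU0 : 0 < U) (hU1 : U < 1) (hV0 : 0 < V)
    (hV : V = (1 - q) / q * ((1 - U) / U))
    (hl : e / 2 ≤ lam) (hb : 0 < b) (hb1 : b ≤ 1) (hbV : 1 / (2 * b) ≤ V / (2 * e))
    (hlb : lam ≤ nearProb e b)
    (hcase : ∀ x, 0 ≤ x → x ≤ 1 → nearProb e x ≤ lam ∨ x ≤ b ∧ 1 / (2 * b) = V / (2 * e)) :
    ∃ A : Assessment, A.IsPBE q U e ∧ A.Truthful ∧
      A.quack = lebPt.withDensity (fun m => ENNReal.ofReal (boxDensity b |(m : ℝ)|)) ∧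
      A.select = cutoffRule e lam := by
  have hVe : V / (4 * e) = V / (2 * e) * (1 / 2) := by field_simp; norm_num
  have hVe0 : 0 < V / (2 * e) := by positivity
  refine exists_cutoff_equilibrium he he' hq0 hq1 hU0 hU1 hV (by linarith)
    (measurable_boxDensity b) (boxDensity_nonneg hb) (lintegral_boxDensity hb hb1) ?_ ?_ ?_
  · intro x s hx0 hx1 hs h
    rcases hcase x hx0 hx1 with h1 | ⟨h1, h2⟩
    · have := upperTail_le he hs.1 (by linarith [hs.2])
      rw [nearProb] at h1
      linarith
    · rw [boxDensity, if_pos h1, h2, hVe] at h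
      have h3 := lt_of_signalDensity_lt he (by linarith [hs.1]) (by linarith [hs.2])
        (lt_of_mul_lt_mul_left h hVe0.le)
      have h4 := upperTail_le he h3.le (by linarith [hs.2])
      rw [upperTail_of_le le_rfl] at h4
      have := upperTail_nonneg he (show x + e ≤ 1 + e by linarith)
      linarith
  · intro x s _ _ _ h
    exfalso
    have h1 : boxDensity b x ≤ V / (2 * e) := by
      unfold boxDensity; split_ifs
      · exact hbV
      · exact hVe0.le
    have := mul_le_mul h1 (signalDensity_le he s) (signalDensity_nonneg he s) hVe0.le
    linarith
  · intro x _ hx1 h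
    have hx : x ≤ b := by
      by_contra hx
      simp [boxDensity, hx] at h
    exact hlb.trans (nearProb_anti he hx hb1)

/-- Because `e / 2 ≤ lam`, after each message some selected signal has the full density `1/2` and
lies strictly below the top of the window. Indifference there gives the constant bound `V / (2 *
e)`. -/
theorem quack_of_box_equilibrium {A B : Assessment} {q U e V lam b : ℝ} (he : 0 < e)
    (he' : e ≤ 1 / 2) (hq0 : 0 < q) (hq1 : q < 1) (hU0 : 0 < U) (hV0 : 0 < V)
    (hV : V = (1 - q) / q * ((1 - U) / U))
    (hA : A.IsPBE q U e) (hAT : A.Truthful) (hB : B.IsPBE q U e) (hBT : B.Truthful)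
    (hl : e / 2 ≤ lam) (hb1 : b ≤ 1) (hlb : lam ≤ nearProb e b)
    (hsel : B.select = cutoffRule e lam)
    (hBq : B.quack = lebPt.withDensity (fun m => ENNReal.ofReal (boxDensity b |(m : ℝ)|))) :
    A.quack ≤ lebPt.withDensity (fun _ => ENNReal.ofReal (V / (2 * e))) ∧
      ∀ᵐ m : Pt ∂A.quack, lam ≤ nearProb e |(m : ℝ)| := by
  have hVe : V / (4 * e) = V / (2 * e) * (1 / 2) := by field_simp; norm_num
  refine quack_of_cutoff_equilibrium (F := fun _ => V / (2 * e)) he he' hq0 hq1 hU0 hV0 hV hA hAT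
    hB hBT (by linarith) hsel (measurable_boxDensity b) hBq ?_ measurable_const
    (fun _ => by positivity) ?_
  · intro x _ hx1 h
    have hx : x ≤ b := by
      by_contra hx
      simp [boxDensity, hx] at h
    exact hlb.trans (nearProb_anti he hx hb1)
  · intro x hx0 hx1
    rcases le_or_gt (x + e) (1 - e) with h | h
    · refine ⟨x, by linarith, by linarith, ?_, ?_⟩
      · rw [upperTail_of_le h, upperTail_of_le (by linarith)]; linarith
      · rw [hVe, signalDensity_eq_half he (by linarith) (by linarith)]
    · refine ⟨1 - e, by linarith, h, ?_, ?_⟩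
      · rw [upperTail_of_le le_rfl]
        have := upperTail_nonneg he (show x + e ≤ 1 + e by linarith)
        linarith
      · rw [hVe, signalDensity_eq_half he (by linarith) le_rfl]

/-- Take `lam = nearProb e b`. Since `b` exceeds `1 - 2 * e`, where `nearProb` is strictly
decreasing, the support lies in `[-b, b]`; the density bound has mass 1 on it, so it is attained. -/
theorem isBestQuack_iff_of_lemonDropping {q U e V : ℝ} (he : 0 < e) (he' : e ≤ 1 / 2)
    (hq0 : 0 < q) (hq1 : q < 1) (hU0 : 0 < U) (hU1 : U < 1)
    (hV : V = (1 - q) / q * ((1 - U) / U)) (h1 : e ≤ V) (h2 : V * (1 - 2 * e) < e)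
    (F : Measure ℝ) : IsBestQuack q U e F ↔ F = uniform (-(e / V)) (e / V) := by
  have hV0 : 0 < V := he.trans_le h1
  set b := e / V with hbdef
  have hb : 0 < b := by positivity
  have hb1 : b ≤ 1 := (div_le_one hV0).2 h1
  have hb2 : 1 - 2 * e < b := by rw [hbdef, lt_div_iff₀ hV0]; linarith
  have hbV : 1 / (2 * b) = V / (2 * e) := by rw [hbdef]; field_simp
  obtain ⟨B, hB, hBT, hBq, hBs⟩ := exists_box_equilibrium he he' hq0 hq1 hU0 hU1 hV0 hV
    (half_le_nearProb he hb1) hb hb1 hbV.le le_rfl (fun x _ hx1 => by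
      rcases le_total x b with h | h
      · exact Or.inr ⟨h, hbV⟩
      · exact Or.inl (nearProb_anti he h hx1))
  rw [isBestQuack_iff he hq0 hq1 hU0 hV]
  constructor
  · rintro ⟨A, hA, hAT, rfl⟩
    obtain ⟨h3, h4⟩ := quack_of_box_equilibrium he he' hq0 hq1 hU0 hV0 hV hA hAT hB hBT
      (half_le_nearProb he hb1) hb1 le_rfl hBs hBq
    have h5 : ∀ᵐ m : Pt ∂A.quack, |(m : ℝ)| ≤ b := by
      filter_upwards [h4] with m hm
      by_contra h
      exact absurd (nearProb_lt he (not_le.1 h) (by linarith [not_le.1 h]) (abs_pt_le_one m))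
        (not_lt.2 hm)
    have hms : MeasurableSet {m : Pt | |(m : ℝ)| ≤ b} :=
      measurableSet_le (by fun_prop) measurable_const
    have h6 : A.quack ≤ B.quack := by
      rw [← Measure.restrict_eq_self_of_ae_mem (s := {m : Pt | |(m : ℝ)| ≤ b}) h5]
      refine (Measure.restrict_mono le_rfl h3).trans (le_of_eq ?_)
      rw [hBq, restrict_withDensity hms, ← withDensity_indicator hms]
      congr 1
      ext m
      simp only [indicator, mem_ofPred_eq, boxDensity, hbV]
      split_ifs <;> simp
    have := A.quack_prob
    have := B.quack_prob
    rw [← quackDist_eq_uniform hb hb1 hBq, Assessment.quackDist, Assessment.quackDist,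
      Measure.eq_of_le_of_isProbabilityMeasure h6]
  · rintro rfl
    exact ⟨B, hB, hBT, quackDist_eq_uniform hb hb1 hBq⟩

/-- Here `lam = e` and the judge selects every signal within `e` of the message. All messages with
`|m| ≤ 1 - 2 * e` are equally good for the quack, which leaves slack in the density bound. -/
theorem isBestQuack_uniform_iff {q U e V : ℝ} (he : 0 < e) (he' : e ≤ 1 / 2)
    (hq0 : 0 < q) (hq1 : q < 1) (hU0 : 0 < U) (hU1 : U < 1)
    (hV : V = (1 - q) / q * ((1 - U) / U)) (h1 : e ≤ V) (h2 : e ≤ V * (1 - 2 * e))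
    {b : ℝ} (hb : 0 < b) :
    IsBestQuack q U e (uniform (-b) b) ↔ b ∈ Icc (e / V) (1 - 2 * e) := by
  have hV0 : 0 < V := he.trans_le h1
  have hex : ∀ c ∈ Icc (e / V) (1 - 2 * e), ∃ A : Assessment, A.IsPBE q U e ∧ A.Truthful ∧
      A.quack = lebPt.withDensity (fun m => ENNReal.ofReal (boxDensity c |(m : ℝ)|)) ∧
      A.select = cutoffRule e e := by
    intro c hc
    have hc0 : 0 < c := lt_of_lt_of_le (by positivity) hc.1
    refine exists_box_equilibrium he he' hq0 hq1 hU0 hU1 hV0 hV (by linarith) hc0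
      (by linarith [hc.2]) ?_ (nearProb_eq_self he hc.2).ge
      fun x _ hx1 => Or.inl (nearProb_le he hx1)
    have := (div_le_iff₀ hV0).1 hc.1
    rw [div_le_div_iff₀ (by positivity) (by positivity)]
    linarith
  rw [isBestQuack_iff he hq0 hq1 hU0 hV]
  constructor
  · rintro ⟨A, hA, hAT, hAu⟩
    have hc : e / V ≤ 1 - 2 * e := by rw [div_le_iff₀ hV0]; linarith
    obtain ⟨B, hB, hBT, hBq, hBs⟩ := hex (e / V) ⟨le_rfl, hc⟩
    obtain ⟨h3, h4⟩ := quack_of_box_equilibrium he he' hq0 hq1 hU0 hV0 hV hA hAT hB hBT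
      (by linarith) (by linarith) (nearProb_eq_self he hc).ge hBs hBq
    have hI : ∀ a c : ℝ, MeasurableSet (Icc a c) := fun a c => measurableSet_Icc
    have hunif : ∀ c, uniform (-b) b (Icc (-c) c) =
        ENNReal.ofReal (1 / (2 * b)) * volume (Icc (-c) c ∩ Icc (-b) b) := by
      intro c
      rw [uniform_eq (by linarith), sub_neg_eq_add, ← two_mul, Measure.smul_apply,
        Measure.restrict_apply (hI _ _), smul_eq_mul]
    have hval : ∀ c, uniform (-b) b (Icc (-c) c) = A.quack {m : Pt | |(m : ℝ)| ≤ c} := by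
      intro c
      rw [← hAu, Assessment.quackDist, Measure.map_apply measurable_subtype_coe (hI _ _)]
      congr 1; ext m; simp [abs_le]
    constructor
    -- The density bound, evaluated on `[-b, b]`, gives `1 ≤ V / (2 * e) * (2 * b)`.
    · have h5 := h3 {m : Pt | |(m : ℝ)| ≤ b}
      rw [← hval, hunif, inter_self, Real.volume_Icc, withDensity_const, Measure.smul_apply,
        smul_eq_mul, ← ENNReal.ofReal_mul (by positivity)] at h5
      have h6 : lebPt {m : Pt | |(m : ℝ)| ≤ b} ≤ ENNReal.ofReal (2 * b) := by
        have : {m : Pt | |(m : ℝ)| ≤ b} = Subtype.val ⁻¹' Icc (-b) b := by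
          ext m; simp [abs_le]
        rw [this, ← Measure.map_apply measurable_subtype_coe (hI _ _), map_val_lebPt]
        refine (Measure.restrict_apply_le _ _).trans (le_of_eq ?_)
        rw [Real.volume_Icc]; congr 1; ring
      have h7 := h5.trans (mul_le_mul_right h6 _)
      rw [← ENNReal.ofReal_mul (by positivity), ENNReal.ofReal_le_ofReal_iff (by positivity)] at h7
      rw [div_le_iff₀ hV0]
      field_simp at h7
      linarith
    · by_contra h
      rw [not_le] at h
      -- Beyond `1 - 2 * e` the selection probability falls below `lam = e`. A uniform distribution
      -- on a longer interval would have mass there.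
      have h5 : ∀ᵐ m : Pt ∂A.quack, |(m : ℝ)| ≤ 1 - 2 * e := by
        filter_upwards [h4] with m hm
        by_contra h
        have h' := nearProb_lt he (not_le.1 h) (not_le.1 h) (abs_pt_le_one m)
        rw [nearProb_eq_self he le_rfl] at h'
        linarith
      have := A.quack_prob
      have h6 : A.quack {m : Pt | |(m : ℝ)| ≤ 1 - 2 * e} = 1 := 
        (mem_ae_iff_prob_eq_one (measurableSet_le (by fun_prop) measurable_const)).1 h5
      have h7 : 0 ≤ 1 - 2 * e := le_trans (by positivity) hc
      rw [← hval, hunif, inter_eq_self_of_subset_left (Icc_subset_Icc (by linarith) h.le),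
        Real.volume_Icc, ← ENNReal.ofReal_mul (by positivity), ENNReal.ofReal_eq_one] at h6
      field_simp at h6
      linarith
  · intro hbI
    obtain ⟨B, hB, hBT, hBq, -⟩ := hex b hbI
    exact ⟨B, hB, hBT, quackDist_eq_uniform hb (by linarith [hbI.2]) hBq⟩

/-! ### Cherry-picking: the equation for `z`, the density and its equilibrium. -/

/-- The right-hand side vanishes at `0`, has derivative `-2 * y ^ 2 / (1 - y ^ 2)`, and is unbounded
below near `1`. -/
theorem existsUnique_artanh {c : ℝ} (hc : c < 0) :
    ∃ z ∈ Ioo (0 : ℝ) 1, ∀ y ∈ Ioo (0 : ℝ) 1, c = 2 * y - 2 * Real.artanh y ↔ y = z := by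
  set k : ℝ → ℝ := fun y => 2 * y - Real.log (1 + y) + Real.log (1 - y) with hk
  have hart : ∀ y ∈ Ioo (0 : ℝ) 1, 2 * y - 2 * Real.artanh y = k y := by
    intro y hy
    rw [Real.artanh_eq_half_log ⟨by linarith [hy.1], hy.2.le⟩,
      Real.log_div (by linarith [hy.1]) (by linarith [hy.2])]
    simp only [hk]; ring
  have hderiv : ∀ y ∈ Ico (0 : ℝ) 1, HasDerivAt k (2 - 1 / (1 + y) + -1 / (1 - y)) y := by
    intro y hy
    have h1 : HasDerivAt (fun y : ℝ => 1 + y) 1 y := (hasDerivAt_id y).const_add 1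
    have h2 : HasDerivAt (fun y : ℝ => 1 - y) (-1) y := (hasDerivAt_id y).const_sub 1
    have h3 : HasDerivAt (fun y : ℝ => 2 * y) 2 y := by
      simpa using (hasDerivAt_id y).const_mul (2 : ℝ)
    exact (h3.sub (h1.log (by linarith [hy.1]))).add (h2.log (by linarith [hy.2]))
  have hcont : ContinuousOn k (Ico 0 1) := fun y hy => (hderiv y hy).continuousAt.continuousWithinAt
  have hanti : StrictAntiOn k (Ico 0 1) := by
    refine strictAntiOn_of_deriv_neg (convex_Ico 0 1) hcont fun y hy => ?_
    rw [interior_Ico] at hy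
    rw [(hderiv y ⟨hy.1.le, hy.2⟩).deriv]
    have h1 : 0 < 1 + y := by linarith [hy.1]
    have h2 : 0 < 1 - y := by linarith [hy.2]
    have h3 : 2 - 1 / (1 + y) + -1 / (1 - y) = -(2 * y ^ 2) / ((1 + y) * (1 - y)) := by
      field_simp; ring
    rw [h3]
    exact div_neg_of_neg_of_pos (by nlinarith [hy.1]) (by positivity)
  have hexp : Real.exp (c - 3) < 1 := by
    rw [Real.exp_lt_one_iff]; linarith
  -- With this point `log (1 - y₁) = c - 3`; since `2 * y₁ < 3` and `log (1 + y₁) ≥ 0`, the value of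
  -- `k` is at most `c`.
  set y₁ := 1 - Real.exp (c - 3) with hy₁
  have hy0 : 0 < y₁ := by linarith
  have hy1 : y₁ < 1 := by linarith [Real.exp_pos (c - 3)]
  have hky : k y₁ ≤ c := by
    have h1 : Real.log (1 - y₁) = c - 3 := by
      rw [hy₁, sub_sub_cancel, Real.log_exp]
    have h2 : 0 ≤ Real.log (1 + y₁) := Real.log_nonneg (by linarith)
    simp only [hk, h1]; linarith
  have hk0 : k 0 = 0 := by simp [hk]
  obtain ⟨z, hz, hzc⟩ := intermediate_value_Icc' hy0.le
    (hcont.mono (Icc_subset_Ico_right hy1)) ⟨hky, by rw [hk0]; exact hc.le⟩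
  have hz0 : z ≠ 0 := by rintro rfl; linarith
  have hz1 : z ∈ Ioo (0 : ℝ) 1 := ⟨lt_of_le_of_ne hz.1 hz0.symm, hz.2.trans_lt hy1⟩
  refine ⟨z, hz1, fun y hy => ?_⟩
  rw [hart y hy, ← hzc]
  constructor
  · exact fun h => (hanti.injOn ⟨hz1.1.le, hz1.2⟩ ⟨hy.1.le, hy.2⟩ h).symm
  · rintro rfl; rfl

/-- The denominator of the cherry-picking density at `x ≥ 0`. -/
def cherryRoot (e z x : ℝ) : ℝ :=
  √(min ((1 - x) ^ 2 + 4 * e ^ 2 * (1 - z ^ 2)) (4 * e ^ 2))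

theorem continuous_cherryRoot (e z : ℝ) : Continuous (cherryRoot e z) := by
  unfold cherryRoot; fun_prop

section

variable {e z : ℝ}

theorem sq_cherryRoot (hz : z ∈ Ioo (0 : ℝ) 1) (x : ℝ) :
    cherryRoot e z x ^ 2 = min ((1 - x) ^ 2 + 4 * e ^ 2 * (1 - z ^ 2)) (4 * e ^ 2) := by
  have : 0 ≤ 1 - z ^ 2 := by nlinarith [hz.1, hz.2]
  exact Real.sq_sqrt (le_min (by positivity) (by positivity))

theorem cherryRoot_pos (he : 0 < e) (hz : z ∈ Ioo (0 : ℝ) 1) (x : ℝ) : 0 < cherryRoot e z x := by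
  have : 0 < 1 - z ^ 2 := by nlinarith [hz.1, hz.2]
  exact Real.sqrt_pos.2 (lt_min (by positivity) (by positivity))

theorem cherryRoot_le (he : 0 < e) (hz : z ∈ Ioo (0 : ℝ) 1) (x : ℝ) :
    cherryRoot e z x ≤ 2 * e := by
  have h := (sq_cherryRoot (e := e) hz x).le.trans (min_le_right _ _)
  exact le_of_pow_le_pow_left₀ two_ne_zero (by positivity) (h.trans_eq (by ring))

theorem cherryRoot_of_le (he : 0 < e) (hz : z ∈ Ioo (0 : ℝ) 1) {x : ℝ}
    (hx : x ≤ 1 - 2 * e * z) : cherryRoot e z x = 2 * e := by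
  have h0 : 0 ≤ 2 * e * z := by have := hz.1; positivity
  have h : (2 * e * z) ^ 2 ≤ (1 - x) ^ 2 := pow_le_pow_left₀ h0 (by linarith) 2
  rw [cherryRoot, min_eq_right (by linarith), show 4 * e ^ 2 = (2 * e) ^ 2 by ring,
    Real.sqrt_sq (by positivity)]

theorem cherryRoot_of_ge {x : ℝ} (hx : 1 - 2 * e * z ≤ x) (hx1 : x ≤ 1) :
    cherryRoot e z x = √((1 - x) ^ 2 + 4 * e ^ 2 * (1 - z ^ 2)) := by
  have h : (1 - x) ^ 2 ≤ (2 * e * z) ^ 2 := pow_le_pow_left₀ (by linarith) (by linarith) 2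
  rw [cherryRoot, min_eq_left (by linarith)]

theorem cherryDensity_eq (he : 0 < e) (hz : z ∈ Ioo (0 : ℝ) 1) (V : ℝ) {m : ℝ} (hm : |m| ≤ 1) :
    cherryDensity V e z m = V / cherryRoot e z |m| := by
  rw [cherryDensity]
  split_ifs with h
  · rw [cherryRoot_of_le he hz h]
  · rw [cherryRoot_of_ge (not_le.1 h).le hm]

theorem continuous_div_cherryRoot (he : 0 < e) (hz : z ∈ Ioo (0 : ℝ) 1) (V : ℝ) :
    Continuous fun x => V / cherryRoot e z x :=
  continuous_const.div (continuous_cherryRoot e z) fun x => (cherryRoot_pos he hz x).ne'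

theorem integral_div_cherryRoot (he : 0 < e) (he' : e ≤ 1 / 2) (hz : z ∈ Ioo (0 : ℝ) 1) (V : ℝ) :
    ∫ x in (0 : ℝ)..1, V / cherryRoot e z x =
      V * ((1 - 2 * e * z) / (2 * e) + Real.artanh z) := by
  have hi : ∀ a b, IntervalIntegrable (fun x => V / cherryRoot e z x) volume a b := fun a b =>
    (continuous_div_cherryRoot he hz V).intervalIntegrable a b
  have hz1 : 0 < 1 - z ^ 2 := by nlinarith [hz.1, hz.2]
  have hez : 0 < 2 * e * z := by have := hz.1; positivity
  have hc0 : 0 ≤ 1 - 2 * e * z := by nlinarith [hz.1, hz.2]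
  set c := 1 - 2 * e * z with hc
  rw [← intervalIntegral.integral_add_adjacent_intervals (hi 0 c) (hi c 1)]
  have h1 : ∫ x in (0 : ℝ)..c, V / cherryRoot e z x = V * (c / (2 * e)) := by
    rw [intervalIntegral.integral_congr (g := fun _ => V / (2 * e)) fun x hx => ?_]
    · simp; ring
    · rw [uIcc_of_le hc0] at hx
      simp only [cherryRoot_of_le he hz hx.2]
  set a := 2 * e * √(1 - z ^ 2) with ha
  have ha0 : 0 < a := by have := Real.sqrt_pos.2 hz1; positivity
  have ha2 : a ^ 2 = 4 * e ^ 2 * (1 - z ^ 2) := by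
    rw [ha, mul_pow, Real.sq_sqrt hz1.le]; ring
  have h2 : ∫ x in c..1, V / cherryRoot e z x = V * Real.artanh z := by
    rw [intervalIntegral.integral_eq_sub_of_hasDerivAt
      (f := fun x => -(V * Real.arsinh ((1 - x) / a))) (fun x hx => ?_) (hi c 1)]
    -- Both equal `z / √(1 - z ^ 2)`, so the `arsinh` primitive evaluates to `artanh z`.
    · have h3 : (1 - c) / a = Real.sinh (Real.artanh z) := by
        rw [Real.sinh_artanh ⟨by linarith [hz.1], hz.2⟩, hc, ha, sub_sub_cancel,
          mul_div_mul_left _ _ (by positivity)]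
      rw [h3, Real.arsinh_sinh]; simp
    · rw [uIcc_of_le (by linarith)] at hx
      have h3 : HasDerivAt (fun x : ℝ => (1 - x) / a) (-1 / a) x :=
        ((hasDerivAt_id x).const_sub 1).div_const a
      have h6 : HasDerivAt (fun x => -(V * Real.arsinh ((1 - x) / a))) _ x :=
        ((h3.arsinh).const_mul V).neg
      refine h6.congr_deriv ?_
      rw [cherryRoot_of_ge hx.1 hx.2, ← ha2]
      have h4 : (1 - x) ^ 2 + a ^ 2 = a ^ 2 * (1 + ((1 - x) / a) ^ 2) := by field_simp; ring
      rw [h4, Real.sqrt_mul (by positivity), Real.sqrt_sq ha0.le]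
      have h5 : 0 < √(1 + ((1 - x) / a) ^ 2) := Real.sqrt_pos.2 (by positivity)
      simp only [smul_eq_mul]
      field_simp
  rw [h1, h2]; ring

/-- The equation for `z` is precisely the normalization to mass `1/2` on each half of `[-1, 1]`. -/
theorem lintegral_div_cherryRoot (he : 0 < e) (he' : e ≤ 1 / 2) (hz : z ∈ Ioo (0 : ℝ) 1) {V : ℝ}
    (hV : 0 < V) (hzV : 1 / e - 1 / V = 2 * z - 2 * Real.artanh z) :
    ∫⁻ x in Icc (-1 : ℝ) 1, ENNReal.ofReal (V / cherryRoot e z |x|) = 1 := by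
  have hc : Continuous fun x : ℝ => V / cherryRoot e z |x| :=
    (continuous_div_cherryRoot he hz V).comp continuous_abs
  have h0 : ∀ x : ℝ, 0 ≤ V / cherryRoot e z |x| := fun x =>
    div_nonneg hV.le (cherryRoot_pos he hz _).le
  have hpos : ∫ x in (0 : ℝ)..1, V / cherryRoot e z |x| = 1 / 2 := by
    rw [intervalIntegral.integral_congr (g := fun x => V / cherryRoot e z x) fun x hx => ?_,
      integral_div_cherryRoot he he' hz]
    · have h1 : Real.artanh z = z - (1 / e - 1 / V) / 2 := by linarith
      rw [h1]; field_simp; ring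
    · rw [uIcc_of_le zero_le_one] at hx
      simp only [abs_of_nonneg hx.1]
  have hneg : ∫ x in (-1 : ℝ)..0, V / cherryRoot e z |x| = 1 / 2 := by
    have := intervalIntegral.integral_comp_neg (a := 0) (b := 1)
      (fun x : ℝ => V / cherryRoot e z |x|)
    simp only [abs_neg, neg_zero] at this
    rw [← this, hpos]
  rw [← ofReal_integral_eq_lintegral_ofReal (hc.continuousOn.integrableOn_Icc)
    (ae_of_all _ h0), integral_Icc_eq_integral_Ioc,
    ← intervalIntegral.integral_of_le (by norm_num),
    ← intervalIntegral.integral_add_adjacent_intervals (hc.intervalIntegrable (-1) 0)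
      (hc.intervalIntegrable 0 1), hpos, hneg]
  norm_num

theorem four_mul_signalDensity {s : ℝ} (he : 0 < e) (he' : e ≤ 1 / 2) (h1 : 1 - e ≤ s)
    (h2 : s ≤ 1 + e) : 4 * e * signalDensity e s = 1 + e - s := by
  rw [signalDensity_eq he (by linarith) h2, max_eq_left (by linarith)]
  field_simp; ring

/-- For `s ≥ 1 - e` both `4 * e * g s` and the square root of `8 * e` times the tail are `1 + e -
s`. With `lam = e * (1 - z ^ 2) / 2`, and `x ≥ 1 - 2 * e`, the cutoff tail times `8 * e` is the
uncapped expression under the root, so comparing densities amounts to comparing tails. -/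
theorem upperTail_le_of_lt_cherryRoot (he : 0 < e) (he' : e ≤ 1 / 2) (hz : z ∈ Ioo (0 : ℝ) 1)
    {x s : ℝ} (hx0 : 0 ≤ x) (hx1 : x ≤ 1) (hs : s ∈ Icc (x - e) (x + e))
    (h : 4 * e * signalDensity e s < cherryRoot e z x) :
    upperTail e s ≤ upperTail e (x + e) + e * (1 - z ^ 2) / 2 := by
  have hz1 : 0 < 1 - z ^ 2 := by nlinarith [hz.1, hz.2]
  have h5 : 1 - e < s := lt_of_signalDensity_lt he (by linarith [hs.1]) (by linarith [hs.2])
    (by have := cherryRoot_le he hz x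
        exact lt_of_mul_lt_mul_left (a := 4 * e) (by linarith) (by positivity))
  have h6 : s ≤ 1 + e := by linarith [hs.2]
  rw [four_mul_signalDensity he he' h5.le h6] at h
  have h7 : (1 + e - s) ^ 2 ≤ cherryRoot e z x ^ 2 := pow_le_pow_left₀ (by linarith) h.le 2
  rw [sq_cherryRoot hz, le_min_iff] at h7
  rcases le_total (x + e) (1 - e) with h8 | h8
  · have h9 := upperTail_le he h5.le h6
    have h10 := upperTail_le he h8 (by linarith)
    have : 0 < e * (1 - z ^ 2) / 2 := by positivity
    linarith
  · rw [upperTail_of_ge he h5.le, upperTail_of_ge he h8, div_add' _ _ _ (by positivity)]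
    refine div_le_div_of_nonneg_right ?_ (by positivity)
    nlinarith [h7.1]

/-- Since `4 * e * g s ≤ 2 * e`, the cap in `cherryRoot` cannot bind, which places the cutoff in the
sloping part of the signal density. -/
theorem lt_upperTail_of_cherryRoot_lt (he : 0 < e) (he' : e ≤ 1 / 2) (hz : z ∈ Ioo (0 : ℝ) 1)
    {x s : ℝ} (hx1 : x ≤ 1) (hs : s ∈ Icc (x - e) (x + e))
    (h : cherryRoot e z x < 4 * e * signalDensity e s) :
    upperTail e (x + e) + e * (1 - z ^ 2) / 2 < upperTail e s := by
  have hz1 : 0 < 1 - z ^ 2 := by nlinarith [hz.1, hz.2]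
  have h5 : cherryRoot e z x < 2 * e := by
    have := mul_le_mul_of_nonneg_left (signalDensity_le he s) (by positivity : 0 ≤ 4 * e)
    linarith
  have h6 : cherryRoot e z x ^ 2 < 4 * e ^ 2 := by
    have := cherryRoot_pos he hz x
    nlinarith
  have h7 : cherryRoot e z x ^ 2 = (1 - x) ^ 2 + 4 * e ^ 2 * (1 - z ^ 2) := by
    rw [sq_cherryRoot hz] at h6 ⊢
    exact min_eq_left (le_of_lt (by simpa using h6))
  have h8 : 1 - e ≤ x + e := by
    have : 0 < 4 * e ^ 2 * (1 - z ^ 2) := by positivity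
    nlinarith
  have h9 : upperTail e (x + e) + e * (1 - z ^ 2) / 2 = cherryRoot e z x ^ 2 / (8 * e) := by
    rw [upperTail_of_ge he h8, h7]; field_simp; ring
  rw [h9]
  rcases le_total s (1 - e) with h10 | h10
  · have := upperTail_le he h10 (by linarith)
    rw [upperTail_of_le le_rfl] at this
    refine lt_of_lt_of_le ?_ this
    rw [div_lt_iff₀ (by positivity)]
    linarith
  · rw [four_mul_signalDensity he he' h10 (by linarith [hs.2])] at h
    rw [upperTail_of_ge he h10]
    exact div_lt_div_of_pos_right
      (pow_lt_pow_left₀ h (cherryRoot_pos he hz x).le (by norm_num)) (by positivity)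

theorem mul_one_sub_sq_le_nearProb (he : 0 < e) {x : ℝ} (hx : x ≤ 1) :
    e * (1 - z ^ 2) / 2 ≤ nearProb e x := by
  have := half_le_nearProb he hx
  nlinarith [sq_nonneg z]

theorem exists_cherry_equilibrium {q U V : ℝ} (he : 0 < e) (he' : e ≤ 1 / 2) (hq0 : 0 < q)
    (hq1 : q < 1) (hU0 : 0 < U) (hU1 : U < 1) (hV0 : 0 < V)
    (hV : V = (1 - q) / q * ((1 - U) / U)) (hz : z ∈ Ioo (0 : ℝ) 1)
    (hzV : 1 / e - 1 / V = 2 * z - 2 * Real.artanh z) :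
    ∃ A : Assessment, A.IsPBE q U e ∧ A.Truthful ∧
      A.quack = lebPt.withDensity (fun m => ENNReal.ofReal (V / cherryRoot e z |(m : ℝ)|)) ∧
      A.select = cutoffRule e (e * (1 - z ^ 2) / 2) := by
  have hz1 : 0 < 1 - z ^ 2 := by nlinarith [hz.1, hz.2]
  have hlt : ∀ x g : ℝ, V / cherryRoot e z x * g < V / (4 * e) ↔ 4 * e * g < cherryRoot e z x := by
    intro x g
    have := cherryRoot_pos he hz x
    rw [div_mul_eq_mul_div, div_lt_div_iff₀ this (by positivity), mul_assoc,
      mul_lt_mul_iff_right₀ hV0, mul_comm g]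
  have hgt : ∀ x g : ℝ, V / (4 * e) < V / cherryRoot e z x * g ↔ cherryRoot e z x < 4 * e * g := by
    intro x g
    have := cherryRoot_pos he hz x
    rw [div_mul_eq_mul_div, div_lt_div_iff₀ (by positivity) this, mul_assoc,
      mul_lt_mul_iff_right₀ hV0, mul_comm g]
  refine exists_cutoff_equilibrium (f := fun x => V / cherryRoot e z x) he he' hq0 hq1 hU0 hU1 hV (by positivity)
    (continuous_div_cherryRoot he hz V).measurable
    (fun x => div_nonneg hV0.le (cherryRoot_pos he hz _).le)
    (lintegral_div_cherryRoot he he' hz hV0 hzV) ?_ ?_ ?_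
  · intro x s hx0 hx1 hs h
    exact upperTail_le_of_lt_cherryRoot he he' hz hx0 hx1 hs ((hlt x _).1 h)
  · intro x s _ hx1 hs h
    exact lt_upperTail_of_cherryRoot_lt he he' hz hx1 hs ((hgt x _).1 h)
  · exact fun x _ hx1 _ => mul_one_sub_sq_le_nearProb he hx1

theorem quack_of_cherry_equilibrium {A B : Assessment} {q U V : ℝ} (he : 0 < e)
    (he' : e ≤ 1 / 2) (hq0 : 0 < q) (hq1 : q < 1) (hU0 : 0 < U) (hV0 : 0 < V)
    (hV : V = (1 - q) / q * ((1 - U) / U)) (hz : z ∈ Ioo (0 : ℝ) 1)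
    (hA : A.IsPBE q U e) (hAT : A.Truthful) (hB : B.IsPBE q U e) (hBT : B.Truthful)
    (hsel : B.select = cutoffRule e (e * (1 - z ^ 2) / 2))
    (hBq : B.quack =
      lebPt.withDensity (fun m => ENNReal.ofReal (V / cherryRoot e z |(m : ℝ)|))) :
    A.quack ≤ B.quack := by
  have hz1 : 0 < 1 - z ^ 2 := by nlinarith [hz.1, hz.2]
  have hm := (continuous_div_cherryRoot he hz V).measurable
  rw [hBq]
  refine (quack_of_cutoff_equilibrium he he' hq0 hq1 hU0 hV0 hV hA hAT hB hBT (by positivity) hsel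
    hm hBq ?_ hm (fun x => div_nonneg hV0.le (cherryRoot_pos he hz _).le) ?_).1
  · exact fun x _ hx1 _ => mul_one_sub_sq_le_nearProb he hx1
  · intro x hx0 hx1
    have hD := cherryRoot_pos he hz x
    have hD2 := cherryRoot_le he hz x
    rcases le_or_gt (x + e) (1 - e) with h | h
    · have h1 : e * (1 - z ^ 2) ≤ e := by nlinarith [sq_nonneg z]
      have h2 : 0 < e * (1 - z ^ 2) := by positivity
      -- The cutoff itself: the window lies where the density is `1/2`, so probability `lam`
      -- corresponds to length `2 * lam`.
      refine ⟨x + e - e * (1 - z ^ 2), by linarith, by linarith, ?_, ?_⟩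
      · rw [upperTail_of_le h, upperTail_of_le (by linarith)]; linarith
      · rw [signalDensity_eq_half he (by linarith) (by linarith), div_mul_div_comm, mul_one]
        exact div_le_div_of_nonneg_left hV0.le (by positivity) (by linarith)
    · have h1 := sq_cherryRoot (e := e) hz x
      have h2 : 1 - x < cherryRoot e z x := by
        refine lt_of_pow_lt_pow_left₀ 2 hD.le ?_
        rw [h1]
        have : 0 < 4 * e ^ 2 * (1 - z ^ 2) := by positivity
        exact lt_min (by linarith) (by nlinarith)
      -- The signal in the sloping part at which density `V / cherryRoot` makes the judge exactly
      -- indifferent; it is selected since `cherryRoot ^ 2` is at most the uncapped expression.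
      refine ⟨1 + e - cherryRoot e z x, by linarith, by linarith, ?_, ?_⟩
      · rw [upperTail_of_ge he (by linarith), upperTail_of_ge he h.le,
          div_add' _ _ _ (by positivity)]
        refine div_le_div_of_nonneg_right ?_ (by positivity)
        have := h1.le.trans (min_le_left _ _)
        nlinarith
      · have h3 := four_mul_signalDensity he he' (s := 1 + e - cherryRoot e z x) (by linarith)
          (by linarith)
        have h4 : signalDensity e (1 + e - cherryRoot e z x) = cherryRoot e z x / (4 * e) := by
          rw [eq_div_iff (by positivity)]; linarith
        rw [h4]
        refine le_of_eq ?_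
        field_simp

theorem isBestQuack_iff_of_cherryPicking {q U V : ℝ} (he : 0 < e) (he' : e ≤ 1 / 2)
    (hq0 : 0 < q) (hq1 : q < 1) (hU0 : 0 < U) (hU1 : U < 1) (hV0 : 0 < V)
    (hV : V = (1 - q) / q * ((1 - U) / U)) (hz : z ∈ Ioo (0 : ℝ) 1)
    (hzV : 1 / e - 1 / V = 2 * z - 2 * Real.artanh z) (F : Measure ℝ) :
    IsBestQuack q U e F ↔ F = cherryDist V e z := by
  obtain ⟨B, hB, hBT, hBq, hBs⟩ := exists_cherry_equilibrium he he' hq0 hq1 hU0 hU1 hV0 hV hz hzV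
  have hdist : B.quackDist = cherryDist V e z := by
    have hm : Measurable fun x : ℝ => ENNReal.ofReal (V / cherryRoot e z |x|) :=
      ((continuous_div_cherryRoot he hz V).comp continuous_abs).measurable.ennreal_ofReal
    rw [Assessment.quackDist, hBq, cherryDist]
    refine (map_val_withDensity hm).trans (withDensity_congr_ae ?_)
    filter_upwards [ae_restrict_mem measurableSet_Icc] with x hx
    rw [cherryDensity_eq he hz V (abs_le.2 hx)]
  rw [isBestQuack_iff he hq0 hq1 hU0 hV]
  constructor
  · rintro ⟨A, hA, hAT, rfl⟩
    have h := quack_of_cherry_equilibrium he he' hq0 hq1 hU0 hV0 hV hz hA hAT hB hBT hBs hBq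
    have := A.quack_prob
    have := B.quack_prob
    rw [← hdist, Assessment.quackDist, Assessment.quackDist,
      Measure.eq_of_le_of_isProbabilityMeasure h]
  · rintro rfl
    exact ⟨B, hB, hBT, hdist⟩

end

end OneSpeaker

end

theorem mainTheorem12 (q U eps V : ℝ) (hq0 : 0 < q) (hq1 : q < 1) (hU0 : 0 < U) (hU1 : U < 1)
    (heps0 : 0 < eps) (heps1 : eps ≤ 1 / 2) (hV : V = (1 - q) / q * ((1 - U) / U)) :
    -- lemon-dropping setting, `eps ≤ V < eps / (1 - 2 * eps)`
    (eps ≤ V → V * (1 - 2 * eps) < eps →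
      ∀ F : Measure ℝ, OneSpeaker.IsBestQuack q U eps F ↔
        F = OneSpeaker.uniform (-(eps / V)) (eps / V)) ∧
    -- lemon-dropping setting, `eps / (1 - 2 * eps) ≤ V`
    (eps ≤ V → eps ≤ V * (1 - 2 * eps) →
      ∀ b : ℝ, 0 < b → b ≤ 1 →
        (OneSpeaker.IsBestQuack q U eps (OneSpeaker.uniform (-b) b) ↔
          b ∈ Icc (eps / V) (1 - 2 * eps))) ∧
    -- cherry-picking setting
    (V < eps →
      ∃ z ∈ Ioo (0 : ℝ) 1,
        (∀ y ∈ Ioo (0 : ℝ) 1, 1 / eps - 1 / V = 2 * y - 2 * Real.artanh y ↔ y = z) ∧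
        ∀ F : Measure ℝ, OneSpeaker.IsBestQuack q U eps F ↔
          F = OneSpeaker.cherryDist V eps z) := by
  have hV0 : 0 < V := by
    rw [hV]; exact mul_pos (div_pos (by linarith) hq0) (div_pos (by linarith) hU0)
  refine ⟨fun h1 h2 F => ?_, fun h1 h2 b hb _ => ?_, fun h => ?_⟩
  · exact OneSpeaker.isBestQuack_iff_of_lemonDropping heps0 heps1 hq0 hq1 hU0 hU1 hV h1 h2 F
  · exact OneSpeaker.isBestQuack_uniform_iff heps0 heps1 hq0 hq1 hU0 hU1 hV h1 h2 hb
  · have hc : 1 / eps - 1 / V < 0 := sub_neg.2 (one_div_lt_one_div_of_lt hV0 h)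
    obtain ⟨z, hz, hzu⟩ := OneSpeaker.existsUnique_artanh hc
    exact ⟨z, hz, hzu, OneSpeaker.isBestQuack_iff_of_cherryPicking heps0 heps1 hq0 hq1 hU0 hU1 hV0
      hV hz ((hzu z hz).2 rfl)⟩
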